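/- Let $\alpha:\mathbb{N}\to\mathbb{R}$ satisfy $\alpha(n)\to\infty$ and $\alpha(n)=o(\log n)$ as $n\to\infty$, where $\log$ is the natural logarithm, and let $p=p(n)\in[0,1]$ with $p(n)=\frac{\log n+\alpha(n)}{n}$ for all sufficiently large $n$. Let $G=G(n,p)$ be the random graph on $n$ labelled vertices in which each of the $\binom n2$ pairs of vertices is an edge with probability $p$, independently of the other pairs. Let $V_2$ be the set of large vertices of $G$, that is, of those vertices whose degree in $G$ is at least $\frac{\log n}{10}$. Then with high probability the induced subgraph $G[V_2]$ is Hamiltonian, that is, $$\Pr\bigl[\,G[V_2]\text{ contains a cycle through all vertices of }V_2\,\bigr]\longrightarrow 1\qquad(n\to\infty).$$ -/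

import Mathlib

open Filter Topology Asymptotics

/-- The set `V₂` of large vertices of a graph on `n` labelled vertices: those whose degree in the
whole graph is at least `(log n) / 10` (natural logarithm). -/
def largeVertices {n : ℕ} (G : SimpleGraph (Fin n)) : Set (Fin n) :=
  open Classical in {v | Real.log n / 10 ≤ (G.degree v : ℝ)}

/-- A graph has a Hamiltonian cycle: a closed walk that is a cycle (so it has at least three
vertices) and passes through every vertex exactly once. -/
def HasHamiltonianCycle {V : Type*} [DecidableEq V] (G : SimpleGraph V) : Prop :=
  ∃ (v : V) (c : G.Walk v v), c.IsHamiltonianCycle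

/-! Write L = log n and let W be the set of large vertices; eventually L/n ≤ p ≤ 2L/n. At this
density the obstruction to Hamiltonicity is local, namely vertices of low degree. With high
probability no vertex has three small neighbours, so a large vertex keeps degree at least L/10 - 2
inside W. Moreover no small set spans many edges, and large disjoint sets have many edges between
them. Then G[W] has a connected spanning subgraph Γ₀ in which every set of at most n/8 vertices has
at least twice as many outer neighbours (`two_mul_card_le_outerNeighbours`,
`exists_adj_sdiff_of_expansion`). It can be kept sparse: d = ⌈L/10000⌉ edges chosen at each vertex,
plus O(n) edges meeting all large cuts (`exists_edges_hitting_cuts`).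

If G[W] is not Hamiltonian, let Γ be Γ₀ together with one longest path of G[W]. Pósa rotations give
at least ⌊n/8⌋²/2 pairs that are ends of longest paths of Γ. These paths are also longest in G[W],
so an edge of G at such a pair would close one of them to a cycle; by connectedness that cycle is
Hamiltonian or opens to a longer path. Hence none of these boosters is an edge of G
(`exists_disjoint_boosters`). Putting the longest path into Γ at once avoids adding boosters one by
one.

A union bound over all Γ with at most nL/5000 edges excludes this: Γ ⊆ G has probability p^|Γ|, and
missing all boosters costs a further factor exp(-pn²/200), which beats the number of choices of Γ
(`prob_hasUnusedBoosters_le`). -/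

section RandomGraph

/-! ### Generating functions and Markov bounds for the binomial random graph. -/

variable {V : Type*} [Fintype V] [DecidableEq V]

open Classical in
/-- The edges of a graph on a finite vertex type, as a finset. -/
noncomputable def edgesOf (G : SimpleGraph V) : Finset (Sym2 V) :=
  Finset.univ.filter fun e => e ∈ G.edgeSet

variable (V) in
/-- All unordered pairs of distinct vertices. -/
def pairsOf : Finset (Sym2 V) :=
  Finset.univ.filter fun e => ¬ e.IsDiag

omit [DecidableEq V] in
@[simp] lemma mem_edgesOf {G : SimpleGraph V} {e : Sym2 V} : e ∈ edgesOf G ↔ e ∈ G.edgeSet := by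
  simp [edgesOf]

@[simp] lemma mem_pairsOf {e : Sym2 V} : e ∈ pairsOf V ↔ ¬ e.IsDiag := by
  simp [pairsOf]

lemma edgesOf_subset_pairsOf (G : SimpleGraph V) : edgesOf G ⊆ pairsOf V := fun e he => by
  simpa using G.not_isDiag_of_mem_edgeSet (by simpa using he)

lemma edgesOf_fromEdgeSet {s : Finset (Sym2 V)} (hs : s ⊆ pairsOf V) :
    edgesOf (SimpleGraph.fromEdgeSet (s : Set (Sym2 V))) = s := by
  ext e
  have := @hs e
  simp at this ⊢
  exact this

omit [DecidableEq V] in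
lemma fromEdgeSet_edgesOf (G : SimpleGraph V) :
    SimpleGraph.fromEdgeSet (edgesOf G : Set (Sym2 V)) = G := by
  have : (edgesOf G : Set (Sym2 V)) = G.edgeSet := by ext; simp
  rw [this, SimpleGraph.fromEdgeSet_edgeSet]

lemma card_pairsOf : (pairsOf V).card = (Fintype.card V).choose 2 := by
  rw [← Sym2.card_diagSet_compl, ← Set.toFinset_card]
  congr 1
  ext e
  simp

lemma card_pairsOf_le : ((pairsOf V).card : ℝ) ≤ (Fintype.card V : ℝ) ^ 2 / 2 := by
  rw [card_pairsOf, Nat.cast_choose_two]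
  nlinarith [(Nat.cast_nonneg (Fintype.card V) : (0 : ℝ) ≤ _)]

/-- Summing over graphs is summing over sets of pairs. -/
lemma sum_graph_eq_sum_powerset (f : Finset (Sym2 V) → ℝ) :
    ∑ G : SimpleGraph V, f (edgesOf G) = ∑ s ∈ (pairsOf V).powerset, f s := by
  refine Finset.sum_bij' (fun G _ => edgesOf G)
    (fun s _ => SimpleGraph.fromEdgeSet (s : Set (Sym2 V))) ?_ ?_ ?_ ?_ ?_
  · exact fun G _ => Finset.mem_powerset.2 (edgesOf_subset_pairsOf G)
  · exact fun s _ => Finset.mem_univ _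
  · exact fun G _ => fromEdgeSet_edgesOf G
  · exact fun s hs => edgesOf_fromEdgeSet (Finset.mem_powerset.1 hs)
  · exact fun G _ => rfl

lemma binomialRandom_real_singleton (p : unitInterval) (G : SimpleGraph V) :
    (SimpleGraph.binomialRandom V p).real {G} =
      (p : ℝ) ^ (edgesOf G).card * (1 - p : ℝ) ^ (pairsOf V \ edgesOf G).card := by
  have h : G.edgeSet.ncard = (edgesOf G).card := by
    rw [← Set.ncard_coe_finset]; congr 1; ext; simp
  rw [Finset.card_sdiff_of_subset (edgesOf_subset_pairsOf G), card_pairsOf,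
    MeasureTheory.measureReal_def, SimpleGraph.binomialRandom_singleton, h,
    Nat.card_eq_fintype_card]
  simp

/-- Independence of the pairs in generating-function form: expanding the product on the right over
subsets of pairs yields one term per graph. -/
lemma sum_binomialRandom_mul_prod (p : unitInterval) (f g : Sym2 V → ℝ) :
    ∑ G : SimpleGraph V, (SimpleGraph.binomialRandom V p).real {G} *
      ((∏ e ∈ edgesOf G, f e) * ∏ e ∈ pairsOf V \ edgesOf G, g e) =
      ∏ e ∈ pairsOf V, (p * f e + (1 - p) * g e) := by
  simp_rw [binomialRandom_real_singleton]
  rw [sum_graph_eq_sum_powerset (fun s => (p : ℝ) ^ s.card * (1 - p : ℝ) ^ (pairsOf V \ s).card *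
    ((∏ e ∈ s, f e) * ∏ e ∈ pairsOf V \ s, g e)), Finset.prod_add]
  refine Finset.sum_congr rfl fun s _ => ?_
  rw [Finset.prod_mul_distrib, Finset.prod_mul_distrib, Finset.prod_const, Finset.prod_const]
  ring

/-- Weight 0 for an absent pair of A kills the graphs that miss part of A; weight y marks the
present pairs of B. -/
lemma sum_binomialRandom_ite_pow (p : unitInterval) {A B : Finset (Sym2 V)}
    (hA : A ⊆ pairsOf V) (hB : B ⊆ pairsOf V) (hAB : Disjoint A B) (y : ℝ) :
    ∑ G : SimpleGraph V, (SimpleGraph.binomialRandom V p).real {G} *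
      (if A ⊆ edgesOf G then y ^ (edgesOf G ∩ B).card else 0) =
      (p : ℝ) ^ A.card * (1 + p * (y - 1)) ^ B.card := by
  have key := sum_binomialRandom_mul_prod p (fun e => if e ∈ B then y else 1)
    (fun e => if e ∈ A then 0 else 1)
  have hR : ∏ e ∈ pairsOf V, ((p : ℝ) * (if e ∈ B then y else 1) +
      (1 - p) * (if e ∈ A then 0 else 1)) = (p : ℝ) ^ A.card * (1 + p * (y - 1)) ^ B.card := by
    have : ∀ e ∈ pairsOf V, ((p : ℝ) * (if e ∈ B then y else 1) +
        (1 - p) * (if e ∈ A then 0 else 1)) =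
        (if e ∈ A then (p : ℝ) else 1) * (if e ∈ B then (1 + p * (y - 1)) else 1) := by
      intro e _
      by_cases h1 : e ∈ A
      · have h2 : e ∉ B := Finset.disjoint_left.1 hAB h1
        simp [h1, h2]
      · by_cases h2 : e ∈ B <;> (simp [h1, h2]; try ring)
    rw [Finset.prod_congr rfl this, Finset.prod_mul_distrib, Finset.prod_ite_mem,
      Finset.prod_ite_mem, Finset.inter_eq_right.2 hA, Finset.inter_eq_right.2 hB,
      Finset.prod_const, Finset.prod_const]
  rw [← hR, ← key]
  refine Finset.sum_congr rfl fun G _ => ?_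
  congr 1
  rw [Finset.prod_ite_mem, Finset.prod_const]
  split_ifs with h
  · rw [Finset.prod_eq_one, mul_one]
    intro e he
    rw [if_neg]
    intro heA
    exact (Finset.mem_sdiff.1 he).2 (h heA)
  · obtain ⟨e, heA, heG⟩ := Finset.not_subset.1 h
    rw [Finset.prod_eq_zero (i := e), mul_zero]
    · exact Finset.mem_sdiff.2 ⟨hA heA, heG⟩
    · simp [heA]

lemma measureReal_le_sum_mul {Ω : Type*} [Fintype Ω] [MeasurableSpace Ω]
    [MeasurableSingletonClass Ω] (μ : MeasureTheory.Measure Ω) [MeasureTheory.IsFiniteMeasure μ]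
    (S : Set Ω) (F : Ω → ℝ) (h0 : ∀ ω, 0 ≤ F ω) (h1 : ∀ ω ∈ S, 1 ≤ F ω) :
    μ.real S ≤ ∑ ω, μ.real {ω} * F ω := by
  classical
  have : μ.real S = ∑ ω ∈ S.toFinset, μ.real {ω} := by
    rw [MeasureTheory.sum_measureReal_singleton, Set.coe_toFinset]
  rw [this]
  calc ∑ ω ∈ S.toFinset, μ.real {ω} ≤ ∑ ω ∈ S.toFinset, μ.real {ω} * F ω :=
        Finset.sum_le_sum fun ω hω =>
          le_mul_of_one_le_right MeasureTheory.measureReal_nonneg (h1 ω (by simpa using hω))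
    _ ≤ _ := Finset.sum_le_sum_of_subset_of_nonneg (Finset.subset_univ _)
        fun ω _ _ => mul_nonneg MeasureTheory.measureReal_nonneg (h0 ω)

instance : MeasurableSingletonClass (SimpleGraph V) where
  measurableSet_singleton G := by
    have : ({G} : Set (SimpleGraph V)) = SimpleGraph.edgeSet ⁻¹' {G.edgeSet} := by
      ext H; simp
    rw [this]
    exact SimpleGraph.measurable_edgeSet (MeasurableSet.of_discrete)

/-- Exponential Markov inequality for the number of edges in `B`, on the event that all of `A` is
present. -/
lemma binomialRandom_real_le_of_pow (p : unitInterval) {A B : Finset (Sym2 V)}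
    (hA : A ⊆ pairsOf V) (hB : B ⊆ pairsOf V) (hAB : Disjoint A B) {y c : ℝ} (hy : 0 ≤ y)
    (hc : 0 < c) (S : Set (SimpleGraph V))
    (hS : ∀ G ∈ S, A ⊆ edgesOf G ∧ c ≤ y ^ (edgesOf G ∩ B).card) :
    (SimpleGraph.binomialRandom V p).real S ≤
      (p : ℝ) ^ A.card * Real.exp (p * (y - 1) * B.card) / c := by
  have h1 := measureReal_le_sum_mul (SimpleGraph.binomialRandom V p) S
    (fun G => (if A ⊆ edgesOf G then y ^ (edgesOf G ∩ B).card else 0) / c)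
    (fun G => by positivity) (fun G hG => by
      rw [if_pos (hS G hG).1, one_le_div hc]
      exact (hS G hG).2)
  refine h1.trans ?_
  simp_rw [← mul_div_assoc]
  rw [← Finset.sum_div, sum_binomialRandom_ite_pow p hA hB hAB]
  have hp0 : (0 : ℝ) ≤ p := p.2.1
  have hp1 : (p : ℝ) ≤ 1 := p.2.2
  gcongr
  rw [mul_comm _ (B.card : ℝ), Real.exp_nat_mul]
  refine pow_le_pow_left₀ ?_ ?_ _
  · nlinarith [mul_nonneg hp0 hy]
  · linarith [Real.add_one_le_exp ((p : ℝ) * (y - 1))]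

/-- Union bound over a finite index set. -/
lemma measureReal_le_sum_of_subset {Ω ι : Type*} [MeasurableSpace Ω]
    (μ : MeasureTheory.Measure Ω) [MeasureTheory.IsFiniteMeasure μ] (s : Finset ι) (S : Set Ω)
    (T : ι → Set Ω) (b : ι → ℝ) (hS : ∀ ω ∈ S, ∃ i ∈ s, ω ∈ T i)
    (hb : ∀ i ∈ s, μ.real (T i) ≤ b i) : μ.real S ≤ ∑ i ∈ s, b i := by
  calc μ.real S ≤ μ.real (⋃ i ∈ s, T i) :=
        MeasureTheory.measureReal_mono (fun ω hω => by simpa using hS ω hω)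
          (MeasureTheory.measure_ne_top _ _)
    _ ≤ ∑ i ∈ s, μ.real (T i) := MeasureTheory.measureReal_biUnion_finset_le s T
    _ ≤ _ := Finset.sum_le_sum hb

end RandomGraph

/-! ### Pósa rotations, endpoints and boosters. -/

section Rotation

variable {V : Type*}

/-- A list of vertices which forms a path of `G`. -/
def IsPathList (G : SimpleGraph V) (l : List V) : Prop :=
  l.Nodup ∧ l.IsChain G.Adj

/-- A path of maximum length, as a list of vertices. -/
def IsLongestPath (G : SimpleGraph V) (l : List V) : Prop :=
  IsPathList G l ∧ ∀ l', IsPathList G l' → l'.length ≤ l.length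

/-- The pair `e` is not a pair of consecutive entries of `l`. -/
def Avoids (l : List V) (e : Sym2 V) : Prop :=
  l.IsChain fun a b => s(a, b) ≠ e

/-- One rotation: the initial segment of the path up to the predecessor of a neighbour `u` of the
first vertex is reversed. -/
def Rotates (G : SimpleGraph V) (l l' : List V) : Prop :=
  ∃ (xs ys : List V) (a q u : V), l = xs ++ q :: u :: ys ∧ l.head? = some a ∧ G.Adj a u ∧
    l' = q :: xs.reverse ++ u :: ys

lemma IsPathList.reverse {G : SimpleGraph V} {l : List V} (h : IsPathList G l) :
    IsPathList G l.reverse := by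
  refine ⟨List.nodup_reverse.2 h.1, List.isChain_reverse.2 ?_⟩
  exact h.2.imp fun _ _ h => h.symm

lemma IsLongestPath.reverse {G : SimpleGraph V} {l : List V} (h : IsLongestPath G l) :
    IsLongestPath G l.reverse :=
  ⟨h.1.reverse, fun l' hl' => by simpa using h.2 l' hl'⟩

lemma avoids_reverse {l : List V} {e : Sym2 V} : Avoids l.reverse e ↔ Avoids l e := by
  unfold Avoids
  rw [List.isChain_reverse]
  simp_rw [Sym2.eq_swap]

lemma Rotates.perm {G : SimpleGraph V} {l l' : List V} (h : Rotates G l l') : l'.Perm l := by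
  obtain ⟨xs, ys, a, q, u, rfl, -, -, rfl⟩ := h
  have : (q :: xs.reverse).Perm (xs ++ [q]) := by
    simpa using List.reverse_perm (xs ++ [q])
  simpa using this.append_right (u :: ys)

lemma Rotates.getLast? {G : SimpleGraph V} {l l' : List V} (h : Rotates G l l') :
    l'.getLast? = l.getLast? := by
  obtain ⟨xs, ys, a, q, u, rfl, -, -, rfl⟩ := h
  rw [List.getLast?_append, show xs ++ q :: u :: ys = (xs ++ [q]) ++ u :: ys by simp,
    List.getLast?_append]
  cases h : (u :: ys).getLast? with
  | none => simp at h
  | some b => simp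

lemma head?_eq_getLast?_reverse_cons {xs : List V} {q a u : V} {ys : List V}
    (h : (xs ++ q :: u :: ys).head? = some a) : (q :: xs.reverse).getLast? = some a := by
  cases xs with
  | nil => simpa using h
  | cons x xs => simp at h; simp [h, List.getLast?_cons]

lemma Rotates.isChain {G : SimpleGraph V} {l l' : List V} (h : Rotates G l l')
    (hl : l.IsChain G.Adj) : l'.IsChain G.Adj := by
  obtain ⟨xs, ys, a, q, u, rfl, ha, hau, rfl⟩ := h
  rw [List.isChain_split] at hl
  rw [List.isChain_append]
  refine ⟨?_, ?_, ?_⟩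
  · have := List.isChain_reverse.2 (hl.1.imp fun _ _ h => h.symm)
    simpa using this
  · have := hl.2
    rw [List.isChain_cons_cons] at this
    exact this.2
  · rw [head?_eq_getLast?_reverse_cons ha]
    simpa using hau

lemma Rotates.isPathList {G : SimpleGraph V} {l l' : List V} (h : Rotates G l l')
    (hl : IsPathList G l) : IsPathList G l' :=
  ⟨h.perm.nodup_iff.2 hl.1, h.isChain hl.2⟩

/-- A rotation changes the path's set of consecutive pairs only by removing {q, u} and inserting {a,
u}. -/
lemma rotates_avoids {xs ys : List V} {a q u : V} (ha : (xs ++ q :: u :: ys).head? = some a)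
    {e : Sym2 V} (h1 : s(q, u) ≠ e) (h2 : s(a, u) ≠ e) :
    Avoids (q :: xs.reverse ++ u :: ys) e ↔ Avoids (xs ++ q :: u :: ys) e := by
  have h3 : Avoids (q :: xs.reverse) e ↔ Avoids (xs ++ [q]) e := by
    rw [← avoids_reverse]; simp
  unfold Avoids at *
  rw [List.isChain_append, h3, List.isChain_split (l₂ := u :: ys), List.isChain_cons_cons,
    head?_eq_getLast?_reverse_cons ha]
  simp [h1, h2]

variable [Fintype V]

open Classical in
/-- The first vertices of the paths obtained from `l` by rotations. -/
noncomputable def rotationEnds (G : SimpleGraph V) (l : List V) : Finset V :=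
  Finset.univ.filter fun a => ∃ l', Relation.ReflTransGen (Rotates G) l l' ∧ l'.head? = some a

lemma mem_rotationEnds {G : SimpleGraph V} {l : List V} {a : V} :
    a ∈ rotationEnds G l ↔
      ∃ l', Relation.ReflTransGen (Rotates G) l l' ∧ l'.head? = some a := by
  simp [rotationEnds]

omit [Fintype V] in
lemma rotations_invariant {G : SimpleGraph V} {l l' : List V} (hl : IsPathList G l)
    (h : Relation.ReflTransGen (Rotates G) l l') :
    IsPathList G l' ∧ l'.Perm l ∧ l'.getLast? = l.getLast? := by
  induction h with
  | refl => exact ⟨hl, List.Perm.refl _, rfl⟩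
  | tail _ hr ih => exact ⟨hr.isPathList ih.1, hr.perm.trans ih.2.1, hr.getLast?.trans ih.2.2⟩

/-- The core of Pósa's argument: if y never becomes an end and is not next to an end on `l`, then no
rotation touches the path pairs at y. -/
lemma rotations_avoids {G : SimpleGraph V} {l l' : List V}
    (h : Relation.ReflTransGen (Rotates G) l l') {y : V} (hy : y ∉ rotationEnds G l)
    (hA : ∀ x ∈ rotationEnds G l, Avoids l s(x, y)) (x : V) :
    Avoids l' s(x, y) ↔ Avoids l s(x, y) := by
  induction h generalizing x with
  | refl => rfl
  | tail hr hs ih =>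
    rename_i m m'
    have hm' : Relation.ReflTransGen (Rotates G) l m' := hr.tail hs
    obtain ⟨xs, ys, a, q, u, rfl, ha, hau, rfl⟩ := hs
    have hqA : q ∈ rotationEnds G l := mem_rotationEnds.2 ⟨_, hm', by simp⟩
    have haA : a ∈ rotationEnds G l := mem_rotationEnds.2 ⟨_, hr, ha⟩
    -- A rotation at u = y would make q an end while q precedes y on the current path, hence, by
    -- induction, is next to y on `l`.
    have hyu : y ≠ u := by
      rintro rfl
      have := (ih q).2 (hA q hqA)
      unfold Avoids at this
      rw [List.isChain_split, List.isChain_cons_cons] at this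
      exact this.2.1 rfl
    have hyq : y ≠ q := fun h => hy (h ▸ hqA)
    have hya : y ≠ a := fun h => hy (h ▸ haA)
    rw [← ih x]
    apply rotates_avoids ha
    · intro h; simp at h; grind
    · intro h; simp at h; grind

/-- Every neighbour of an endpoint which is not itself an endpoint is next to an endpoint on the
initial path. -/
lemma exists_rotationEnds_not_avoids {G : SimpleGraph V} {l : List V} (hl : IsLongestPath G l)
    {a y : V} (ha : a ∈ rotationEnds G l) (hy : y ∉ rotationEnds G l) (hay : G.Adj a y) :
    ∃ x ∈ rotationEnds G l, ¬ Avoids l s(x, y) := by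
  by_contra! hcon
  obtain ⟨m, hm, hma⟩ := mem_rotationEnds.1 ha
  obtain ⟨hmp, hperm, -⟩ := rotations_invariant hl.1 hm
  -- Otherwise y could be prepended to a longest path.
  have hym : y ∈ m := by
    by_contra hym
    have := hl.2 (y :: m) ⟨List.nodup_cons.2 ⟨hym, hmp.1⟩, by
      rw [List.isChain_cons]
      refine ⟨?_, hmp.2⟩
      rw [hma]
      simpa using hay.symm⟩
    rw [List.length_cons, hperm.length_eq] at this
    omega
  obtain ⟨s, t, rfl⟩ := List.append_of_mem hym
  rcases List.eq_nil_or_concat s with rfl | ⟨xs, q, rfl⟩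
  · simp at hma
    exact hay.ne hma.symm
  · rw [List.concat_eq_append] at hm hma
    have hrot : Rotates G (xs ++ [q] ++ y :: t) (q :: xs.reverse ++ y :: t) :=
      ⟨xs, t, a, q, y, by simp, hma, hay, rfl⟩
    have hq : q ∈ rotationEnds G l := mem_rotationEnds.2 ⟨_, hm.tail hrot, by simp⟩
    have := (rotations_avoids hm hy hcon q).2 (hcon q hq)
    unfold Avoids at this
    simp only [List.append_assoc, List.cons_append, List.nil_append] at this
    rw [List.isChain_split, List.isChain_cons_cons] at this
    exact this.2.1 rfl

/-- Pósa's lemma. -/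
lemma card_neighbours_rotationEnds_lt [DecidableEq V] {G : SimpleGraph V} {l : List V}
    (hl : IsLongestPath G l) (hne : l ≠ []) (N : Finset V)
    (hN : ∀ y ∈ N, y ∉ rotationEnds G l ∧ ∃ a ∈ rotationEnds G l, G.Adj a y) :
    N.card < 2 * (rotationEnds G l).card := by
  set A := rotationEnds G l with hA
  obtain ⟨h, t, rfl⟩ := List.exists_cons_of_ne_nil hne
  set l := h :: t with hlt
  have hh : h ∈ A := mem_rotationEnds.2 ⟨l, Relation.ReflTransGen.refl, by simp [hlt]⟩
  -- Each y is the successor or the predecessor on `l` of an end. The first vertex h is an end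
  -- without predecessor, so it is erased, which makes the bound strict. The `getD` defaults only
  -- add harmless images.
  have hsub : N ⊆ A.image (fun a => l.getD (l.idxOf a + 1) a) ∪
      (A.erase h).image (fun a => l.getD (l.idxOf a - 1) a) := by
    intro y hy
    obtain ⟨hyA, a, ha, hay⟩ := hN y hy
    obtain ⟨x, hx, hxy⟩ := exists_rotationEnds_not_avoids hl ha hyA hay
    unfold Avoids at hxy
    rw [List.isChain_iff_getElem] at hxy
    push Not at hxy
    obtain ⟨i, hi, he⟩ := hxy
    rw [Finset.mem_union, Finset.mem_image, Finset.mem_image]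
    rw [Sym2.eq_iff] at he
    rcases he with ⟨h1, h2⟩ | ⟨h1, h2⟩
    · left
      refine ⟨x, hx, ?_⟩
      rw [← h1, hl.1.1.idxOf_getElem, List.getD_eq_getElem _ _ hi, h2]
    · right
      refine ⟨x, Finset.mem_erase.2 ⟨?_, hx⟩, ?_⟩
      · intro hxh
        rw [hxh] at h2
        have h3 : l[i + 1] = l[0]'(by omega) := by rw [h2]; rfl
        have := (hl.1.1.getElem_inj_iff).1 h3
        omega
      · rw [← h2, hl.1.1.idxOf_getElem, Nat.add_sub_cancel,
          List.getD_eq_getElem _ _ (by omega), h1]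
  have h1 := Finset.card_le_card hsub
  have h2 := Finset.card_union_le (A.image (fun a => l.getD (l.idxOf a + 1) a))
      ((A.erase h).image (fun a => l.getD (l.idxOf a - 1) a))
  have h3 : (A.image (fun a => l.getD (l.idxOf a + 1) a)).card ≤ A.card := Finset.card_image_le
  have h4 : ((A.erase h).image (fun a => l.getD (l.idxOf a - 1) a)).card ≤ (A.erase h).card :=
    Finset.card_image_le
  have h5 := Finset.card_erase_add_one hh
  omega

open Classical in
/-- The vertices outside `S` with a neighbour in `S`. -/
noncomputable def outerNeighbours (G : SimpleGraph V) (S : Finset V) : Finset V :=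
  Finset.univ.filter fun y => y ∉ S ∧ ∃ x ∈ S, G.Adj x y

lemma mem_outerNeighbours {G : SimpleGraph V} {S : Finset V} {y : V} :
    y ∈ outerNeighbours G S ↔ y ∉ S ∧ ∃ x ∈ S, G.Adj x y := by
  simp [outerNeighbours]

/-- A set of at most k ends would have twice as many outer neighbours by expansion, against Pósa's
lemma. -/
lemma lt_card_rotationEnds [DecidableEq V] {G : SimpleGraph V} {l : List V}
    (hl : IsLongestPath G l) (hne : l ≠ []) {W : Finset V} (hW : ∀ v ∈ l, v ∈ W) {k : ℕ}
    (hexp : ∀ S ⊆ W, S.Nonempty → S.card ≤ k → 2 * S.card ≤ (outerNeighbours G S).card) :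
    k < (rotationEnds G l).card := by
  by_contra! hk
  have hsub : rotationEnds G l ⊆ W := by
    intro a ha
    obtain ⟨m, hm, hma⟩ := mem_rotationEnds.1 ha
    exact hW a ((rotations_invariant hl.1 hm).2.1.subset (List.mem_of_head? hma))
  have hnonempty : (rotationEnds G l).Nonempty := by
    obtain ⟨h, t, rfl⟩ := List.exists_cons_of_ne_nil hne
    exact ⟨h, mem_rotationEnds.2 ⟨_, Relation.ReflTransGen.refl, by simp⟩⟩
  have h1 := hexp _ hsub hnonempty hk
  have h2 := card_neighbours_rotationEnds_lt hl hne (outerNeighbours G (rotationEnds G l))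
    (fun y hy => by simpa using mem_outerNeighbours.1 hy)
  omega

open Classical in
/-- The pairs of distinct vertices which are the two ends of a path of maximum length. -/
noncomputable def boosters (G : SimpleGraph V) : Finset (Sym2 V) :=
  Finset.univ.filter fun e => ¬ e.IsDiag ∧
    ∃ l a b, IsLongestPath G l ∧ l.head? = some a ∧ l.getLast? = some b ∧ e = s(a, b)

lemma mem_boosters {G : SimpleGraph V} {e : Sym2 V} : e ∈ boosters G ↔ ¬ e.IsDiag ∧
    ∃ l a b, IsLongestPath G l ∧ l.head? = some a ∧ l.getLast? = some b ∧ e = s(a, b) := by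
  simp [boosters]

/-- In a graph in which small sets expand there are quadratically many boosters. -/
lemma sq_le_two_mul_card_boosters [DecidableEq V] {G : SimpleGraph V} {l : List V}
    (hl : IsLongestPath G l) (hne : l ≠ []) {W : Finset V}
    (hlW : ∀ v ∈ l, v ∈ W) {k : ℕ} (hk : 1 ≤ k)
    (hexp : ∀ S ⊆ W, S.Nonempty → S.card ≤ k → 2 * S.card ≤ (outerNeighbours G S).card) :
    k ^ 2 ≤ 2 * (boosters G).card := by
  classical
  set A := rotationEnds G l
  have hA : k < A.card := lt_card_rotationEnds hl hne hlW hexp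
  have hlen : 2 ≤ l.length := by
    have : A ⊆ l.toFinset := by
      intro a ha
      obtain ⟨m, hm, hma⟩ := mem_rotationEnds.1 ha
      exact List.mem_toFinset.2 ((rotations_invariant hl.1 hm).2.1.subset (List.mem_of_head? hma))
    have h1 := Finset.card_le_card this
    have h2 := List.toFinset_card_le l
    omega
  have hlong : ∀ {m m'}, IsLongestPath G m → Relation.ReflTransGen (Rotates G) m m' →
      IsLongestPath G m' := fun hm h =>
    ⟨(rotations_invariant hm.1 h).1, fun l' hl' =>
      (rotations_invariant hm.1 h).2.1.length_eq ▸ hm.2 l' hl'⟩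
  -- Reversing a rotated path makes a its fixed last vertex; rotating again then produces more than
  -- k partners for each a.
  have hends : ∀ a ∈ A, ∃ m, IsLongestPath G m ∧ m.getLast? = some a ∧ (∀ v ∈ m, v ∈ W) := by
    intro a ha
    obtain ⟨m, hm, hma⟩ := mem_rotationEnds.1 ha
    exact ⟨m.reverse, (hlong hl hm).reverse, by simpa using hma, fun v hv =>
      hlW v ((rotations_invariant hl.1 hm).2.1.subset (List.mem_reverse.1 hv))⟩
  choose! m hm1 hm2 hm3 using hends
  have hlen' : ∀ {m'}, IsLongestPath G m' → 2 ≤ m'.length := fun hm => hlen.trans (hm.2 l hl.1)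
  have hB : ∀ a ∈ A, k < (rotationEnds G (m a)).card := fun a ha =>
    lt_card_rotationEnds (hm1 a ha) (by
      intro h
      have := hlen' (hm1 a ha)
      rw [h] at this
      simp at this) (hm3 a ha) hexp
  set P : Finset (Σ _ : V, V) := A.sigma fun a => rotationEnds G (m a) with hP
  have hPcard : k ^ 2 ≤ P.card := by
    rw [hP, Finset.card_sigma]
    calc k ^ 2 = k * k := sq k
      _ ≤ A.card * k := Nat.mul_le_mul_right _ hA.le
      _ = ∑ a ∈ A, k := by simp
      _ ≤ _ := Finset.sum_le_sum fun a ha => (hB a ha).le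
  refine hPcard.trans ?_
  have himg : P.image (fun x => s(x.1, x.2)) ⊆ boosters G := by
    intro e he
    obtain ⟨⟨a, b⟩, hab, rfl⟩ := Finset.mem_image.1 he
    rw [hP, Finset.mem_sigma] at hab
    obtain ⟨m', hm', hb⟩ := mem_rotationEnds.1 hab.2
    have h1 := hlong (hm1 a hab.1) hm'
    have h2 := (rotations_invariant (hm1 a hab.1).1 hm').2.2.trans (hm2 a hab.1)
    have h3 := hlen' h1
    refine mem_boosters.2 ⟨?_, m', b, a, h1, hb, h2, Sym2.eq_swap⟩
    rw [Sym2.mk_isDiag_iff]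
    simp only
    rintro rfl
    rw [List.head?_eq_getElem?, List.getElem?_eq_getElem (by omega)] at hb
    rw [List.getLast?_eq_getElem?, List.getElem?_eq_getElem (by omega)] at h2
    have := (h1.1.1.getElem_inj_iff).1 (Option.some.inj (hb.trans h2.symm))
    omega
  -- Each unordered pair comes from at most two ordered ones.
  refine (Finset.card_le_mul_card_image P 2 ?_).trans
    (Nat.mul_le_mul_left 2 (Finset.card_le_card himg))
  intro e _
  induction e with | h a b
  calc _ ≤ ({⟨a, b⟩, ⟨b, a⟩} : Finset (Σ _ : V, V)).card := by
        refine Finset.card_le_card ?_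
        rintro ⟨c, d⟩ h
        have := (Finset.mem_filter.1 h).2
        simp only [Sym2.eq_iff] at this
        rcases this with ⟨rfl, rfl⟩ | ⟨rfl, rfl⟩ <;> simp
    _ ≤ 2 := Finset.card_le_two

end Rotation

/-! ### From closed longest paths to Hamiltonian cycles. -/

section Hamiltonian

/-- A path through all vertices whose ends are adjacent gives a Hamiltonian cycle. -/
lemma hasHamiltonianCycle_of_list {U : Type*} [DecidableEq U] {G : SimpleGraph U} {l : List U}
    (hl : IsPathList G l) (hlen : 3 ≤ l.length) {a b : U} (ha : l.head? = some a)
    (hb : l.getLast? = some b) (hab : G.Adj a b) (hcov : ∀ u, u ∈ l) :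
    HasHamiltonianCycle G := by
  have hne : l ≠ [] := by rintro rfl; simp at hlen
  have hha : l.head hne = a := by
    rw [List.head?_eq_some_head hne] at ha; simpa using ha
  have hlb : l.getLast hne = b := by
    rw [List.getLast?_eq_some_getLast hne] at hb; simpa using hb
  set w := SimpleGraph.Walk.ofSupport l hne hl.2 with hw
  have hsupp : w.support = l := SimpleGraph.Walk.support_ofSupport hne hl.2
  have hwlen : w.length + 1 = l.length := by
    rw [← SimpleGraph.Walk.length_support, hsupp]
  have hadj : G.Adj (l.getLast hne) (l.head hne) := by rw [hha, hlb]; exact hab.symm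
  have hpath : w.IsPath := SimpleGraph.Walk.IsPath.mk' (by rw [hsupp]; exact hl.1)
  have : Fintype U := ⟨l.toFinset, fun u => List.mem_toFinset.2 (hcov u)⟩
  have hcard : Fintype.card U = l.length := by
    rw [← List.toFinset_card_of_nodup hl.1, ← Finset.card_univ]
    congr 1
    ext u
    simp [hcov u]
  refine ⟨_, SimpleGraph.Walk.cons hadj w, ?_⟩
  rw [SimpleGraph.Walk.isHamiltonianCycle_iff_isCycle_and_length_eq]
  rw [SimpleGraph.Walk.length_cons, hwlen, hcard,
    SimpleGraph.Walk.isCycle_iff_isPath_tail_and_le_length, SimpleGraph.Walk.length_cons, hwlen]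
  exact ⟨⟨by simpa using hpath, hlen⟩, rfl⟩

variable {V : Type*}

lemma hasHamiltonianCycle_induce [DecidableEq V] {G : SimpleGraph V} {W : Set V} {l : List V}
    (hl : IsPathList G l) (hlen : 3 ≤ l.length) {a b : V} (ha : l.head? = some a)
    (hb : l.getLast? = some b) (hab : G.Adj a b) (hcov : ∀ u, u ∈ l ↔ u ∈ W) :
    HasHamiltonianCycle (G.induce W) := by
  obtain ⟨m, rfl⟩ : ∃ m : List W, m.map Subtype.val = l :=
    ⟨l.attachWith (· ∈ W) fun u hu => (hcov u).1 hu, by simp⟩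
  rw [List.head?_map] at ha
  rw [List.getLast?_map] at hb
  obtain ⟨a', ha', rfl⟩ := Option.map_eq_some_iff.1 ha
  obtain ⟨b', hb', rfl⟩ := Option.map_eq_some_iff.1 hb
  refine hasHamiltonianCycle_of_list (l := m) ⟨?_, ?_⟩ (by simpa using hlen) ha' hb' hab ?_
  · exact List.Nodup.of_map _ hl.1
  · have := hl.2
    rw [List.isChain_map] at this
    exact this
  · intro u
    have := (hcov u).2 u.2
    simpa using this

lemma exists_isLongestPath [Fintype V] (G : SimpleGraph V) : ∃ l, IsLongestPath G l := by
  have hbdd : BddAbove {k | ∃ l, IsPathList G l ∧ l.length = k} :=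
    ⟨Fintype.card V, by rintro _ ⟨l, hl, rfl⟩; exact hl.1.length_le_card⟩
  obtain ⟨l, hl, hlen⟩ := Nat.sSup_mem
    (s := {k | ∃ l, IsPathList G l ∧ l.length = k}) ⟨0, [], ⟨by simp, by simp⟩, rfl⟩ hbdd
  exact ⟨l, hl, fun l' hl' => hlen ▸ le_csSup hbdd ⟨l', hl', rfl⟩⟩

/-- The subgraph of `G` formed by the edges inside `W`, on the same vertex type. -/
def within (G : SimpleGraph V) (W : Finset V) : SimpleGraph V where
  Adj u v := G.Adj u v ∧ u ∈ W ∧ v ∈ W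
  symm := ⟨fun _ _ h => ⟨h.1.symm, h.2.2, h.2.1⟩⟩
  loopless := ⟨fun _ h => h.1.ne rfl⟩

lemma IsPathList.mono {G H : SimpleGraph V} (h : G ≤ H) {l : List V} (hl : IsPathList G l) :
    IsPathList H l :=
  ⟨hl.1, hl.2.imp fun _ _ hab => h hab⟩

/-- The length condition matters: a single vertex outside W is also a path of `within G W`. -/
lemma IsPathList.mem_of_within {G : SimpleGraph V} {W : Finset V} {l : List V}
    (hl : IsPathList (within G W) l) (hlen : 2 ≤ l.length) : ∀ v ∈ l, v ∈ W := by
  intro v hv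
  have hc := hl.2
  rw [List.isChain_iff_getElem] at hc
  obtain ⟨i, hi, rfl⟩ := List.getElem_of_mem hv
  rcases Nat.eq_zero_or_pos i with rfl | hpos
  · exact (hc 0 (by omega)).2.1
  · have := (hc (i - 1) (by omega)).2.2
    simpa [Nat.sub_add_cancel hpos] using this

/-- The graph whose edges are the consecutive pairs of a list. -/
def listGraph (l : List V) : SimpleGraph V := SimpleGraph.fromEdgeSet {e | ¬ Avoids l e}

lemma listGraph_le {G : SimpleGraph V} {l : List V} (hl : l.IsChain G.Adj) : listGraph l ≤ G := by
  intro u v h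
  rw [listGraph, SimpleGraph.fromEdgeSet_adj] at h
  by_contra hne
  refine h.1 (hl.imp ?_)
  intro a b hab he
  rw [Sym2.eq_iff] at he
  rcases he with ⟨rfl, rfl⟩ | ⟨rfl, rfl⟩
  · exact hne hab
  · exact hne hab.symm

lemma isPathList_listGraph {l : List V} (hl : l.Nodup) : IsPathList (listGraph l) l := by
  refine ⟨hl, List.isChain_iff_getElem.2 fun i hi => ?_⟩
  rw [listGraph, SimpleGraph.fromEdgeSet_adj]
  refine ⟨?_, ?_⟩
  · intro h
    exact List.isChain_iff_getElem.1 h i hi rfl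
  · intro h
    have := hl.getElem_inj_iff.1 h
    omega

variable [Fintype V] [DecidableEq V]

lemma card_edgesOf_listGraph_le (l : List V) : (edgesOf (listGraph l)).card ≤ l.length := by
  have : edgesOf (listGraph l) ⊆
      -- At the last index the default gives a diagonal pair, so the bound is one more than needed.
      (Finset.univ : Finset (Fin l.length)).image fun i => s(l.get i, l.getD (i + 1) (l.get i)) := by
    intro e he
    rw [mem_edgesOf, listGraph, SimpleGraph.edgeSet_fromEdgeSet] at he
    have h := he.1
    simp only [Set.mem_ofPred_eq, Avoids] at h
    rw [List.isChain_iff_getElem] at h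
    push Not at h
    obtain ⟨i, hi, rfl⟩ := h
    refine Finset.mem_image.2 ⟨⟨i, by omega⟩, Finset.mem_univ _, ?_⟩
    simp [List.getElem?_eq_getElem hi]
  simpa using (Finset.card_le_card this).trans Finset.card_image_le

omit [DecidableEq V] in
lemma outerNeighbours_mono {G H : SimpleGraph V} (h : G ≤ H) (S : Finset V) :
    outerNeighbours G S ⊆ outerNeighbours H S := fun y hy => by
  rw [mem_outerNeighbours] at *
  exact ⟨hy.1, hy.2.imp fun x hx => ⟨hx.1, h hx.2⟩⟩

omit [DecidableEq V] in
lemma edgesOf_mono {G H : SimpleGraph V} (h : G ≤ H) : edgesOf G ⊆ edgesOf H := fun e he => by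
  rw [mem_edgesOf] at *
  exact SimpleGraph.edgeSet_mono h he

omit [Fintype V] in
/-- A longest path whose ends are adjacent, in a connected graph, closes to a Hamiltonian cycle. -/
lemma hasHamiltonianCycle_of_closed_longest {G : SimpleGraph V} {W : Finset V} {m : List V}
    (hm : IsLongestPath (within G W) m) (hlen : 3 ≤ m.length)
    (hconn : ∀ C ⊆ W, C.Nonempty → C ≠ W → ∃ u ∈ C, ∃ v ∈ W, v ∉ C ∧ G.Adj u v)
    {a b : V} (ha : m.head? = some a) (hb : m.getLast? = some b) (hab : G.Adj a b) :
    HasHamiltonianCycle (G.induce (W : Set V)) := by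
  have hmW := hm.1.mem_of_within (by omega)
  have hwle : within G W ≤ G := fun _ _ h => h.1
  by_cases hC : m.toFinset = W
  · exact hasHamiltonianCycle_induce (hm.1.mono hwle) hlen ha hb hab fun u => by
      rw [← List.mem_toFinset, hC]; simp
  · exfalso
    obtain ⟨u, hu, v, hvW, hvm, huv⟩ := hconn m.toFinset
      (fun v hv => hmW v (List.mem_toFinset.1 hv))
      ⟨a, List.mem_toFinset.2 (List.mem_of_head? ha)⟩ hC
    rw [List.mem_toFinset] at hu hvm
    obtain ⟨s, t, rfl⟩ := List.append_of_mem hu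
    have hperm : (u :: t ++ s).Perm (s ++ u :: t) := List.perm_append_comm
    have hchain := List.isChain_append.1 hm.1.2
    -- The ends a and b are adjacent, so the path closes to a cycle; cutting it just before u and
    -- prepending v gives a longer path.
    have hnew : IsPathList (within G W) (v :: (u :: t ++ s)) := by
      refine ⟨List.nodup_cons.2 ⟨fun h => hvm (hperm.subset h), hperm.nodup_iff.2 hm.1.1⟩, ?_⟩
      rw [List.cons_append, List.isChain_cons_cons]
      refine ⟨⟨huv.symm, hvW, hmW u hu⟩, ?_⟩
      rw [← List.cons_append, List.isChain_append]
      refine ⟨hchain.2.1, hchain.1, ?_⟩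
      intro x hx y hy
      have hxb : x = b := by
        rw [List.getLast?_append] at hb
        rw [Option.mem_def] at hx
        rw [hx] at hb
        simpa using hb
      have hya : y = a := by
        rw [Option.mem_def] at hy
        rw [List.head?_append, hy] at ha
        simpa using ha
      subst hxb hya
      exact ⟨hab.symm, hmW _ (List.mem_of_getLast? hb), hmW _ (List.mem_of_head? ha)⟩
    have := hm.2 _ hnew
    rw [List.length_cons, hperm.length_eq] at this
    omega

/-- If `G[W]` has a spanning connected expander `Γ₀` but no Hamiltonian cycle, then adding a
longest path to `Γ₀` gives a subgraph of `G` none of whose boosters is an edge of `G`. -/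
lemma exists_disjoint_boosters {G Γ₀ : SimpleGraph V} {W : Finset V} (hW : W.Nonempty)
    (hΓ : Γ₀ ≤ within G W) {k : ℕ} (hk : 1 ≤ k)
    (hexp : ∀ S ⊆ W, S.Nonempty → S.card ≤ k → 2 * S.card ≤ (outerNeighbours Γ₀ S).card)
    (hconn : ∀ C ⊆ W, C.Nonempty → C ≠ W → ∃ u ∈ C, ∃ v ∈ W, v ∉ C ∧ Γ₀.Adj u v)
    (hham : ¬ HasHamiltonianCycle (G.induce (W : Set V))) :
    ∃ Γ ≤ G, (edgesOf Γ).card ≤ (edgesOf Γ₀).card + Fintype.card V ∧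
      k ^ 2 ≤ 2 * (boosters Γ).card ∧ Disjoint (boosters Γ) (edgesOf G) := by
  obtain ⟨l, hl⟩ := exists_isLongestPath (within G W)
  -- Expansion of a singleton gives a vertex two neighbours, hence a path on three vertices.
  have hlen : 3 ≤ l.length := by
    obtain ⟨w, hw⟩ := hW
    have h1 := hexp {w} (by simpa using hw) (by simp) (by simpa using hk)
    rw [Finset.card_singleton] at h1
    obtain ⟨x, hx, y, hy, hxy⟩ := Finset.one_lt_card.1 (show 1 < (outerNeighbours Γ₀ {w}).card by omega)
    simp only [mem_outerNeighbours, Finset.mem_singleton, exists_eq_left] at hx hy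
    refine hl.2 [x, w, y] ⟨?_, ?_⟩
    · simp [hx.1, hxy, Ne.symm hy.1]
    · simp [hΓ hy.2, (hΓ hx.2).symm]
  have hwle : within G W ≤ G := fun _ _ h => h.1
  have hle : Γ₀ ⊔ listGraph l ≤ within G W := sup_le hΓ (listGraph_le hl.1.2)
  -- Longest paths of Γ and of `within G W` have the same length, since Γ contains `l`.
  have hlΓ : IsLongestPath (Γ₀ ⊔ listGraph l) l :=
    ⟨(isPathList_listGraph hl.1.1).mono le_sup_right, fun l' hl' => hl.2 l' (hl'.mono hle)⟩
  refine ⟨Γ₀ ⊔ listGraph l, hle.trans hwle, ?_, ?_, ?_⟩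
  · have h1 : edgesOf (Γ₀ ⊔ listGraph l) = edgesOf Γ₀ ∪ edgesOf (listGraph l) := by
      ext e; simp
    rw [h1]
    refine (Finset.card_union_le _ _).trans (Nat.add_le_add_left ?_ _)
    exact (card_edgesOf_listGraph_le l).trans hl.1.1.length_le_card
  · refine sq_le_two_mul_card_boosters hlΓ (by rintro rfl; simp at hlen)
      (hl.1.mem_of_within (by omega)) hk fun S hS hne hcard => ?_
    exact (hexp S hS hne hcard).trans (Finset.card_le_card (outerNeighbours_mono le_sup_left S))
  · rw [Finset.disjoint_left]
    intro e he heG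
    obtain ⟨-, m, a, b, hm, ha, hb, rfl⟩ := mem_boosters.1 he
    have hmlen : l.length ≤ m.length := hm.2 l hlΓ.1
    refine hham (hasHamiltonianCycle_of_closed_longest (m := m)
      ⟨hm.1.mono hle, fun l' hl' => (hl.2 l' hl').trans hmlen⟩ (by omega) ?_ ha hb
      (by simpa using heG))
    intro C hC hCne hCW
    obtain ⟨u, hu, v, hv, hvC, huv⟩ := hconn C hC hCne hCW
    exact ⟨u, hu, v, hv, hvC, (hΓ huv).1⟩

end Hamiltonian

/-- Greedy hitting sets: if every member of a family has density at least `c` in `U`, then some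
`k` elements of `U` hit all but a proportion `(1 - c) ^ k` of the family. -/
lemma exists_hitting_set {ι : Type*} [DecidableEq ι] {U : Finset ι} (hU : U.Nonempty)
    (F : Finset (Finset ι)) {c : ℝ} (hc1 : c ≤ 1)
    (hF : ∀ f ∈ F, f ⊆ U ∧ c * U.card ≤ f.card) (k : ℕ) :
    ∃ D ⊆ U, D.card ≤ k ∧
      ((F.filter fun f => Disjoint D f).card : ℝ) ≤ F.card * (1 - c) ^ k := by
  induction k with
  | zero =>
    refine ⟨∅, by simp, by simp, ?_⟩
    simp
  | succ k ih =>
    obtain ⟨D, hDU, hDk, hD⟩ := ih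
    set F' := F.filter fun f => Disjoint D f with hF'
    -- Double counting: the average element of U lies in a proportion at least c of the sets not yet
    -- hit.
    have hsum : ∑ u ∈ U, (c * F'.card) ≤ ∑ u ∈ U, ((F'.filter fun f => u ∈ f).card : ℝ) := by
      have h1 : ∑ u ∈ U, (F'.filter fun f => u ∈ f).card = ∑ f ∈ F', f.card := by
        simp_rw [Finset.card_eq_sum_ones, Finset.sum_filter]
        rw [Finset.sum_comm]
        refine Finset.sum_congr rfl fun f hf => ?_
        rw [← Finset.sum_filter]
        congr 1
        have := (hF f (Finset.mem_filter.1 hf).1).1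
        ext u
        simp only [Finset.mem_filter]
        exact ⟨fun h => h.2, fun h => ⟨this h, h⟩⟩
      rw [← Nat.cast_sum, h1, Nat.cast_sum, Finset.sum_const, nsmul_eq_mul]
      calc (U.card : ℝ) * (c * F'.card) = ∑ f ∈ F', c * U.card := by
            rw [Finset.sum_const, nsmul_eq_mul]; ring
        _ ≤ _ := Finset.sum_le_sum fun f hf => (hF f (Finset.mem_filter.1 hf).1).2
    obtain ⟨u, huU, hu⟩ := Finset.exists_le_of_sum_le hU hsum
    refine ⟨insert u D, Finset.insert_subset huU hDU,
      (Finset.card_insert_le _ _).trans (by omega), ?_⟩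
    have hsplit : F.filter (fun f => Disjoint (insert u D) f) = F'.filter fun f => ¬ u ∈ f := by
      rw [hF', Finset.filter_filter]
      refine Finset.filter_congr fun f _ => ?_
      rw [Finset.disjoint_insert_left]
      tauto
    have hcard := Finset.card_filter_add_card_filter_not (s := F') (fun f => u ∈ f)
    rw [hsplit]
    have hcard' : ((F'.filter fun f => u ∈ f).card : ℝ) + (F'.filter fun f => ¬ u ∈ f).card =
        F'.card := by exact_mod_cast hcard
    calc ((F'.filter fun f => ¬ u ∈ f).card : ℝ) ≤ (1 - c) * F'.card := by linarith
      _ ≤ (1 - c) * (F.card * (1 - c) ^ k) := by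
          apply mul_le_mul_of_nonneg_left hD; linarith
      _ = _ := by ring

/-! ### Deterministic structure: sparse connected expanders on the large vertices. -/

section Structure

variable {V : Type*} [Fintype V]

open Classical in
/-- The neighbours of a vertex, as a finset. -/
noncomputable def nbrs (G : SimpleGraph V) (v : V) : Finset V :=
  Finset.univ.filter fun u => G.Adj v u

lemma mem_nbrs {G : SimpleGraph V} {u v : V} : u ∈ nbrs G v ↔ G.Adj v u := by simp [nbrs]

variable [DecidableEq V]

/-- The pairs with one vertex in `A` and one in `B`. -/
def crossPairs (A B : Finset V) : Finset (Sym2 V) := (A ×ˢ B).image fun x => s(x.1, x.2)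

/-- The pairs of distinct vertices of `T`. -/
def innerPairs (T : Finset V) : Finset (Sym2 V) := T.offDiag.image fun x => s(x.1, x.2)

/-- Some two disjoint large sets have at most half the expected number of edges between them. -/
def SparseCut (L η : ℝ) (G : SimpleGraph V) : Prop :=
  ∃ A B : Finset V, Disjoint A B ∧ η * Fintype.card V ≤ A.card ∧
    (Fintype.card V : ℝ) / 4 ≤ B.card ∧
    ((edgesOf G ∩ crossPairs A B).card : ℝ) ≤ A.card * B.card * L / (2 * Fintype.card V)

/-- Some vertex has three neighbours of degree below `L / 10`. -/
def SmallStar (L : ℝ) (G : SimpleGraph V) : Prop :=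
  ∃ (v : V) (S : Finset V), v ∉ S ∧ S.card = 3 ∧ (∀ s ∈ S, G.Adj v s) ∧
    ∀ s ∈ S, ((nbrs G s).card : ℝ) < L / 10

/-- Some small set of vertices spans many edges. -/
def DenseSet (L δ θ : ℝ) (G : SimpleGraph V) : Prop :=
  ∃ T : Finset V, T.Nonempty ∧ (T.card : ℝ) ≤ θ * Fintype.card V ∧
    δ * T.card * L / 6 ≤ (edgesOf G ∩ innerPairs T).card

/-- Some subgraph with at most `M` edges has at least `b` boosters, none of them an edge. -/
def HasUnusedBoosters (M b : ℝ) (G : SimpleGraph V) : Prop :=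
  ∃ Γ ≤ G, ((edgesOf Γ).card : ℝ) ≤ M ∧ b ≤ (boosters Γ).card ∧
    Disjoint (boosters Γ) (edgesOf G)

omit [Fintype V] in
lemma mem_crossPairs {A B : Finset V} {e : Sym2 V} :
    e ∈ crossPairs A B ↔ ∃ a ∈ A, ∃ b ∈ B, s(a, b) = e := by
  simp [crossPairs, and_assoc]

omit [Fintype V] in
lemma card_crossPairs {A B : Finset V} (h : Disjoint A B) :
    (crossPairs A B).card = A.card * B.card := by
  rw [crossPairs, Finset.card_image_of_injOn, Finset.card_product]
  rintro ⟨a, b⟩ h1 ⟨c, d⟩ h2 h3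
  simp only [Finset.coe_product, Set.mem_prod, Finset.mem_coe] at h1 h2
  simp only [Sym2.eq_iff] at h3
  rcases h3 with ⟨rfl, rfl⟩ | ⟨rfl, rfl⟩
  · rfl
  · exact absurd h2.2 (Finset.disjoint_left.1 h h1.1)

lemma card_edgesOf_inter_crossPairs_le (G : SimpleGraph V) (A B : Finset V) :
    (edgesOf G ∩ crossPairs A B).card ≤ ∑ a ∈ A, (nbrs G a).card := by
  have : edgesOf G ∩ crossPairs A B ⊆ A.biUnion fun a => (nbrs G a).image fun b => s(a, b) := by
    intro e he
    rw [Finset.mem_inter, mem_crossPairs] at he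
    obtain ⟨he, a, ha, b, hb, rfl⟩ := he
    refine Finset.mem_biUnion.2 ⟨a, ha, Finset.mem_image.2 ⟨b, ?_, rfl⟩⟩
    simpa [mem_nbrs] using he
  refine (Finset.card_le_card this).trans (Finset.card_biUnion_le.trans ?_)
  exact Finset.sum_le_sum fun a _ => Finset.card_image_le

/-- Each large cut contains more than ηnL/8 of the at most 2nL edges, a proportion η/16. There are
at most 4^n cuts, and 32n/η greedy choices leave fewer than 4^n · exp(-2n) < 1 of them unhit. -/
lemma exists_edges_hitting_cuts {G : SimpleGraph V} {L η : ℝ} (hL : 0 < L) (hη : 0 < η)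
    (hη1 : η ≤ 1) (hV : 0 < Fintype.card V) (hcut : ¬ SparseCut L η G)
    (hedge : ((edgesOf G).card : ℝ) ≤ 2 * Fintype.card V * L) :
    ∃ D ⊆ edgesOf G, D.card ≤ ⌈32 * Fintype.card V / η⌉₊ ∧
      ∀ A B : Finset V, Disjoint A B → η * Fintype.card V ≤ A.card →
        (Fintype.card V : ℝ) / 4 ≤ B.card → ∃ a ∈ A, ∃ b ∈ B, s(a, b) ∈ D := by
  classical
  set n := Fintype.card V with hn
  have hn0 : (0 : ℝ) < n := by exact_mod_cast hV
  have hmany : ∀ A B : Finset V, Disjoint A B → η * n ≤ A.card → (n : ℝ) / 4 ≤ B.card →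
      η * n * L / 8 < (edgesOf G ∩ crossPairs A B).card := by
    intro A B hAB hA hB
    by_contra! hcon
    refine hcut ⟨A, B, hAB, hA, hB, hcon.trans ?_⟩
    rw [le_div_iff₀ (by positivity)]
    have h1 : (η * n) * (n / 4) ≤ A.card * B.card :=
      mul_le_mul hA hB (by positivity) (by positivity)
    nlinarith [mul_le_mul_of_nonneg_right h1 hL.le]
  by_cases hU : (edgesOf G).Nonempty
  swap
  · refine ⟨∅, by simp, by simp, fun A B hAB hA hB => ?_⟩
    have := hmany A B hAB hA hB
    rw [Finset.not_nonempty_iff_eq_empty.1 hU] at this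
    simp only [Finset.empty_inter, Finset.card_empty, Nat.cast_zero] at this
    exact absurd this (not_lt.2 (by positivity))
  set F : Finset (Finset (Sym2 V)) := ((Finset.univ : Finset (Finset V × Finset V)).filter
    fun x => Disjoint x.1 x.2 ∧ η * n ≤ x.1.card ∧ (n : ℝ) / 4 ≤ x.2.card).image
      fun x => edgesOf G ∩ crossPairs x.1 x.2 with hF
  have hFcard : (F.card : ℝ) ≤ 4 ^ n := by
    have : F.card ≤ 4 ^ n := by
      refine Finset.card_image_le.trans ((Finset.card_le_card (Finset.filter_subset _ _)).trans ?_)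
      rw [Finset.card_univ, Fintype.card_prod, Fintype.card_finset, ← mul_pow]
      norm_num [hn]
    exact_mod_cast this
  obtain ⟨D, hDU, hDk, hD⟩ := exists_hitting_set hU F (c := η / 16) (by linarith) (by
    intro f hf
    obtain ⟨⟨A, B⟩, hAB, rfl⟩ := Finset.mem_image.1 hf
    have h := (Finset.mem_filter.1 hAB).2
    refine ⟨Finset.inter_subset_left, le_trans ?_ (hmany A B h.1 h.2.1 h.2.2).le⟩
    nlinarith [mul_le_mul_of_nonneg_left hedge hη.le]) ⌈32 * n / η⌉₊
  refine ⟨D, hDU, hDk, fun A B hAB hA hB => ?_⟩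
  have hlt : (F.card : ℝ) * (1 - η / 16) ^ ⌈32 * n / η⌉₊ < 1 := by
    have h1 : (1 - η / 16) ^ ⌈32 * n / η⌉₊ ≤ Real.exp (-(2 * n)) := by
      calc (1 - η / 16) ^ ⌈32 * n / η⌉₊ ≤ Real.exp (-(η / 16)) ^ ⌈32 * n / η⌉₊ := by
            refine pow_le_pow_left₀ (by linarith) ?_ _
            linarith [Real.add_one_le_exp (-(η / 16))]
        _ = Real.exp (-(η / 16 * ⌈32 * n / η⌉₊)) := by
            rw [← Real.exp_nat_mul]; congr 1; ring
        _ ≤ _ := by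
            rw [Real.exp_le_exp, neg_le_neg_iff]
            have := Nat.le_ceil (32 * n / η)
            calc 2 * (n : ℝ) = η / 16 * (32 * n / η) := by field_simp; norm_num
              _ ≤ _ := by gcongr
    calc (F.card : ℝ) * (1 - η / 16) ^ ⌈32 * n / η⌉₊ ≤ 4 ^ n * Real.exp (-(2 * n)) :=
          mul_le_mul hFcard h1 (pow_nonneg (by linarith) _) (by positivity)
      _ = (4 * Real.exp (-2)) ^ n := by
          rw [mul_pow, ← Real.exp_nat_mul]; ring_nf
      _ < 1 := by
          refine pow_lt_one₀ (by positivity) ?_ hV.ne'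
          rw [Real.exp_neg, ← div_eq_mul_inv, div_lt_one (Real.exp_pos _),
            show (2 : ℝ) = 1 + 1 by norm_num, Real.exp_add]
          nlinarith [Real.exp_one_gt_d9]
  have hempty : F.filter (fun f => Disjoint D f) = ∅ := by
    rw [← Finset.card_eq_zero]
    have := hD.trans_lt hlt
    have h2 : (F.filter fun f => Disjoint D f).card < 1 := by exact_mod_cast this
    omega
  have hmem : edgesOf G ∩ crossPairs A B ∈ F :=
    Finset.mem_image.2 ⟨(A, B), Finset.mem_filter.2 ⟨Finset.mem_univ _, hAB, hA, hB⟩, rfl⟩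
  have hnd : ¬ Disjoint D (edgesOf G ∩ crossPairs A B) := by
    intro h
    have : edgesOf G ∩ crossPairs A B ∈ F.filter (fun f => Disjoint D f) :=
      Finset.mem_filter.2 ⟨hmem, h⟩
    rw [hempty] at this
    simp at this
  obtain ⟨e, heD, he⟩ := Finset.not_disjoint_iff.1 hnd
  obtain ⟨a, ha, b, hb, rfl⟩ := mem_crossPairs.1 (Finset.mem_inter.1 he).2
  exact ⟨a, ha, b, hb, heD⟩

/-- Minimum degree, absence of small dense sets, and edges between large sets give expansion. -/
lemma two_mul_card_le_outerNeighbours {G Γ : SimpleGraph V} {W : Finset V} {L δ η : ℝ} {d : ℕ}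
    (hL : 0 < L) (hδ : 0 < δ) (hΓ : Γ ≤ within G W)
    (hd : ∀ w ∈ W, d ≤ (nbrs Γ w).card) (hδd : δ * L ≤ d)
    (hcut : ∀ A B : Finset V, A ⊆ W → B ⊆ W → Disjoint A B → η * Fintype.card V ≤ A.card →
        (Fintype.card V : ℝ) / 4 ≤ B.card → ∃ a ∈ A, ∃ b ∈ B, Γ.Adj a b)
    (hdense : ¬ DenseSet L δ (3 * η) G) (hW : 3 * (Fintype.card V : ℝ) / 4 ≤ W.card)
    {S : Finset V} (hS : S ⊆ W) (hne : S.Nonempty) (hcard : S.card ≤ Fintype.card V / 8) :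
    2 * S.card ≤ (outerNeighbours Γ S).card := by
  classical
  by_contra! hlt
  set N := outerNeighbours Γ S with hN
  have hSpos : (0 : ℝ) < S.card := by exact_mod_cast hne.card_pos
  have hltR : (N.card : ℝ) < 2 * S.card := by exact_mod_cast hlt
  have hTle : ((S ∪ N).card : ℝ) ≤ S.card + N.card := by exact_mod_cast Finset.card_union_le S N
  rcases le_total (S.card : ℝ) (η * Fintype.card V) with hsmall | hbig
  -- All Γ-edges at S lie inside S ∪ N, and each is counted at most twice in the degree sum. As |S ∪
  -- N| ≤ 3|S|, this makes S ∪ N a dense set.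
  · have hdeg : d * S.card ≤ 2 * (edgesOf G ∩ innerPairs (S ∪ N)).card := by
      set P : Finset (Σ _ : V, V) := S.sigma fun w => nbrs Γ w with hP
      have h1 : d * S.card ≤ P.card := by
        rw [hP, Finset.card_sigma]
        calc d * S.card = ∑ w ∈ S, d := by simp [mul_comm]
          _ ≤ _ := Finset.sum_le_sum fun w hw => hd w (hS hw)
      refine h1.trans ((Finset.card_le_mul_card_image (f := fun x => s(x.1, x.2)) P 2 ?_).trans
        (Nat.mul_le_mul_left 2 (Finset.card_le_card ?_)))
      · intro e _
        induction e with | h a b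
        calc _ ≤ ({⟨a, b⟩, ⟨b, a⟩} : Finset (Σ _ : V, V)).card := by
              refine Finset.card_le_card ?_
              rintro ⟨c, d⟩ h
              have := (Finset.mem_filter.1 h).2
              simp only [Sym2.eq_iff] at this
              rcases this with ⟨rfl, rfl⟩ | ⟨rfl, rfl⟩ <;> simp
          _ ≤ 2 := Finset.card_le_two
      · intro e he
        obtain ⟨⟨a, b⟩, hab, rfl⟩ := Finset.mem_image.1 he
        rw [hP, Finset.mem_sigma, mem_nbrs] at hab
        simp only at hab ⊢
        have hb : b ∈ S ∪ N := by
          by_cases hbS : b ∈ S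
          · exact Finset.mem_union_left _ hbS
          · exact Finset.mem_union_right _ (mem_outerNeighbours.2 ⟨hbS, a, hab.1, hab.2⟩)
        rw [Finset.mem_inter, mem_edgesOf, SimpleGraph.mem_edgeSet]
        refine ⟨(hΓ hab.2).1, Finset.mem_image.2 ⟨(a, b), ?_, rfl⟩⟩
        exact Finset.mem_offDiag.2 ⟨Finset.mem_union_left _ hab.1, hb, hab.2.ne⟩
    have hdegR : (d : ℝ) * S.card ≤ 2 * (edgesOf G ∩ innerPairs (S ∪ N)).card := by
      exact_mod_cast hdeg
    refine hdense ⟨S ∪ N, hne.mono Finset.subset_union_left, by nlinarith, ?_⟩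
    have h3 : ((S ∪ N).card : ℝ) ≤ 3 * S.card := by linarith
    have hδL : 0 < δ * L := mul_pos hδ hL
    nlinarith [mul_le_mul_of_nonneg_left h3 hδL.le, mul_le_mul_of_nonneg_right hδd hSpos.le]
  -- Here |S ∪ N| ≤ 3n/8, so at least 3n/8 vertices of W remain, and some edge of Γ joins S to them.
  · have hB : (Fintype.card V : ℝ) / 4 ≤ (W \ (S ∪ N)).card := by
      have h1 : W.card ≤ (W \ (S ∪ N)).card + (S ∪ N).card := by
        have := Finset.le_card_sdiff (S ∪ N) W
        omega
      have h1R : (W.card : ℝ) ≤ (W \ (S ∪ N)).card + (S ∪ N).card := by exact_mod_cast h1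
      have h2 : (S.card : ℝ) ≤ Fintype.card V / 8 :=
        (Nat.cast_le.2 hcard).trans Nat.cast_div_le
      linarith
    obtain ⟨a, ha, b, hb, hab⟩ := hcut S (W \ (S ∪ N)) hS Finset.sdiff_subset
      (Finset.disjoint_left.2 fun x hx hx' =>
        (Finset.mem_sdiff.1 hx').2 (Finset.mem_union_left _ hx)) hbig hB
    have hb' := Finset.mem_sdiff.1 hb
    refine hb'.2 ?_
    by_cases hbS : b ∈ S
    · exact Finset.mem_union_left _ hbS
    · exact Finset.mem_union_right _ (mem_outerNeighbours.2 ⟨hbS, a, ha, hab⟩)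

/-- An expander with edges between all large sets is connected. -/
lemma exists_adj_sdiff_of_expansion {Γ : SimpleGraph V} {W : Finset V} {η : ℝ}
    (hη : η ≤ 1 / 8) (hΓ : ∀ u v, Γ.Adj u v → v ∈ W)
    (hcut : ∀ A B : Finset V, A ⊆ W → B ⊆ W → Disjoint A B → η * Fintype.card V ≤ A.card →
        (Fintype.card V : ℝ) / 4 ≤ B.card → ∃ a ∈ A, ∃ b ∈ B, Γ.Adj a b)
    (hexp : ∀ S ⊆ W, S.Nonempty → S.card ≤ Fintype.card V / 8 →
      2 * S.card ≤ (outerNeighbours Γ S).card)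
    (hW : 3 * (Fintype.card V : ℝ) / 4 ≤ W.card)
    {C : Finset V} (hC : C ⊆ W) (hne : C.Nonempty) (hCW : C ≠ W) :
    ∃ u ∈ C, ∃ v ∈ W, v ∉ C ∧ Γ.Adj u v := by
  classical
  by_contra! hcon
  -- A set without edges to the rest of W has no outer neighbours, so expansion forbids it to be
  -- small. The larger of C and its complement in W has at least 3n/8 vertices, so the cut condition
  -- applies.
  have hbig : ∀ S ⊆ W, S.Nonempty → (∀ u ∈ S, ∀ v ∈ W, v ∉ S → ¬ Γ.Adj u v) →
      η * Fintype.card V ≤ S.card := by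
    intro S hS hSne hSadj
    by_contra! hlt
    have hk : S.card ≤ Fintype.card V / 8 := by
      rw [Nat.le_div_iff_mul_le (by norm_num)]
      have h0 : (0 : ℝ) ≤ Fintype.card V := Nat.cast_nonneg _
      have : (S.card : ℝ) * 8 ≤ Fintype.card V := by nlinarith
      exact_mod_cast this
    have h1 := hexp S hS hSne hk
    have h2 : outerNeighbours Γ S = ∅ := by
      refine Finset.eq_empty_of_forall_notMem fun y hy => ?_
      obtain ⟨hyS, x, hx, hxy⟩ := mem_outerNeighbours.1 hy
      exact hSadj x hx y (hΓ x y hxy) hyS hxy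
    rw [h2, Finset.card_empty] at h1
    have := hSne.card_pos
    omega
  have hCne : (W \ C).Nonempty := by
    rw [Finset.sdiff_nonempty]
    exact fun h => hCW (hC.antisymm h)
  have h1 := hbig C hC hne hcon
  have h2 := hbig (W \ C) Finset.sdiff_subset hCne (by
    intro u hu v hv hvn huv
    have hvC : v ∈ C := by
      by_contra h
      exact hvn (Finset.mem_sdiff.2 ⟨hv, h⟩)
    exact hcon v hvC u (Finset.mem_sdiff.1 hu).1 (Finset.mem_sdiff.1 hu).2 huv.symm)
  have hsum : (C.card : ℝ) + (W \ C).card = W.card := by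
    have := Finset.card_sdiff_add_card_eq_card hC
    exact_mod_cast (by omega : C.card + (W \ C).card = W.card)
  have h0 : (0 : ℝ) ≤ Fintype.card V := Nat.cast_nonneg _
  rcases le_total (C.card : ℝ) (W \ C).card with h | h
  · obtain ⟨a, ha, b, hb, hab⟩ := hcut C (W \ C) hC Finset.sdiff_subset
      Finset.disjoint_sdiff h1 (by linarith)
    exact hcon a ha b (Finset.mem_sdiff.1 hb).1 (Finset.mem_sdiff.1 hb).2 hab
  · obtain ⟨a, ha, b, hb, hab⟩ := hcut (W \ C) C Finset.sdiff_subset hC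
      Finset.sdiff_disjoint h2 (by linarith)
    exact hcon b hb a (Finset.mem_sdiff.1 ha).1 (Finset.mem_sdiff.1 ha).2 hab.symm

open Classical in
/-- The vertices of degree at least `L / 10`. -/
noncomputable def highDegree (L : ℝ) (G : SimpleGraph V) : Finset V :=
  Finset.univ.filter fun v => L / 10 ≤ ((nbrs G v).card : ℝ)

omit [DecidableEq V] in
lemma mem_highDegree {L : ℝ} {G : SimpleGraph V} {v : V} :
    v ∈ highDegree L G ↔ L / 10 ≤ ((nbrs G v).card : ℝ) := by
  simp [highDegree]

/-- Otherwise ⌈n/4⌉ vertices of degree below L/10 send at most |S|L/10 edges to their complement,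
too few for a cut whose other side has at least n/2 vertices. -/
lemma card_highDegree_ge {G : SimpleGraph V} {L η : ℝ} (hL : 0 < L) (hη : η ≤ 1 / 8)
    (hV : 4 ≤ Fintype.card V) (hcut : ¬ SparseCut L η G) :
    3 * (Fintype.card V : ℝ) / 4 ≤ (highDegree L G).card := by
  by_contra! hlt
  have hn4 : (4 : ℝ) ≤ Fintype.card V := by exact_mod_cast hV
  set n : ℝ := ((Fintype.card V : ℕ) : ℝ) with hn
  have hc : ((highDegree L G).card : ℝ) + ((highDegree L G)ᶜ).card = n := by
    rw [hn]; exact_mod_cast Finset.card_add_card_compl _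
  have hs : ⌈n / 4⌉₊ ≤ ((highDegree L G)ᶜ).card := by
    rw [Nat.ceil_le]; linarith
  obtain ⟨S, hS, hScard⟩ := Finset.exists_subset_card_eq hs
  have hS1 : n / 4 ≤ S.card := by rw [hScard]; exact Nat.le_ceil _
  have hS2 : (S.card : ℝ) < n / 4 + 1 := by
    rw [hScard]; exact Nat.ceil_lt_add_one (by positivity)
  have hSc : (S.card : ℝ) + Sᶜ.card = n := by
    rw [hn]; exact_mod_cast Finset.card_add_card_compl _
  refine hcut ⟨S, Sᶜ, disjoint_compl_right, ?_, ?_, ?_⟩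
  · linarith [mul_le_mul_of_nonneg_right hη (by positivity : 0 ≤ n)]
  · linarith
  have h1 : ((edgesOf G ∩ crossPairs S Sᶜ).card : ℝ) ≤ S.card * (L / 10) := by
    have h2 : ((edgesOf G ∩ crossPairs S Sᶜ).card : ℝ) ≤ ∑ s ∈ S, ((nbrs G s).card : ℝ) := by
      exact_mod_cast card_edgesOf_inter_crossPairs_le G S Sᶜ
    refine h2.trans ?_
    rw [← nsmul_eq_mul]
    refine Finset.sum_le_card_nsmul _ _ _ fun s hs => ?_
    have := Finset.mem_compl.1 (hS hs)
    rw [mem_highDegree, not_le] at this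
    exact this.le
  refine h1.trans ?_
  rw [le_div_iff₀ (by linarith)]
  have h3 : n / 2 - 1 / 2 * (n / 4) ≤ (Sᶜ.card : ℝ) := by linarith
  have h4 : 0 ≤ (S.card : ℝ) * L := by positivity
  nlinarith [mul_le_mul_of_nonneg_left h3 h4, mul_nonneg h4 (by linarith : 0 ≤ n)]

/-- Three small neighbours would form a `SmallStar`, so at most two neighbours are lost. -/
lemma card_nbrs_inter_highDegree_ge {G : SimpleGraph V} {L : ℝ} (hstar : ¬ SmallStar L G) {v : V}
    (hv : v ∈ highDegree L G) : L / 10 - 2 ≤ ((nbrs G v ∩ highDegree L G).card : ℝ) := by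
  have h1 : (nbrs G v \ highDegree L G).card ≤ 2 := by
    by_contra! h
    obtain ⟨S, hS, hScard⟩ := Finset.exists_subset_card_eq (Nat.succ_le_of_lt h)
    refine hstar ⟨v, S, fun hvS => ?_, hScard, fun s hs => ?_, fun s hs => ?_⟩
    · exact (Finset.mem_sdiff.1 (hS hvS)).2 hv
    · exact mem_nbrs.1 (Finset.mem_sdiff.1 (hS hs)).1
    · have := (Finset.mem_sdiff.1 (hS hs)).2
      rwa [mem_highDegree, not_le] at this
  have h2 := Finset.card_sdiff_add_card_inter (nbrs G v) (highDegree L G)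
  have h3 : ((nbrs G v \ highDegree L G).card : ℝ) ≤ 2 := by exact_mod_cast h1
  have h4 : ((nbrs G v \ highDegree L G).card : ℝ) + (nbrs G v ∩ highDegree L G).card =
      (nbrs G v).card := by exact_mod_cast h2
  have := mem_highDegree.1 hv
  linarith

/-- Outside the exceptional events the large vertices span a Hamiltonian graph. -/
lemma hasHamiltonianCycle_of_typical {G : SimpleGraph V} {L δ η M b : ℝ} {d : ℕ}
    (hL : 0 < L) (hδ : 0 < δ) (hη : 0 < η) (hη8 : η ≤ 1 / 8) (hV : 8 ≤ Fintype.card V)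
    (hδd : δ * L ≤ d) (hd : (d : ℝ) ≤ L / 10 - 2)
    (hM : (⌈32 * Fintype.card V / η⌉₊ + Fintype.card V * d + Fintype.card V : ℕ) ≤ M)
    (hb : 2 * b ≤ ((Fintype.card V / 8 : ℕ) : ℝ) ^ 2)
    (hcut : ¬ SparseCut L η G) (hstar : ¬ SmallStar L G) (hdense : ¬ DenseSet L δ (3 * η) G)
    (hedge : ((edgesOf G).card : ℝ) ≤ 2 * Fintype.card V * L)
    (hboost : ¬ HasUnusedBoosters M b G) :
    HasHamiltonianCycle (G.induce (highDegree L G : Set V)) := by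
  classical
  by_contra hham
  set W := highDegree L G with hWdef
  have hW := card_highDegree_ge hL hη8 (by omega) hcut
  obtain ⟨H, hHG, hHcard, hH⟩ :=
    exists_edges_hitting_cuts hL hη (by linarith) (by omega) hcut hedge
  -- Only d neighbours per vertex are kept, so that Γ has few enough edges for the union bound over
  -- subgraphs.
  have hsel : ∀ w ∈ W, ∃ N ⊆ nbrs G w ∩ W, N.card = d := fun w hw =>
    Finset.exists_subset_card_eq (by
      have := hd.trans (card_nbrs_inter_highDegree_ge hstar hw)
      exact_mod_cast this)
  choose! N hNsub hNcard using hsel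
  set D : Finset (Sym2 V) := W.biUnion fun w => (N w).image fun u => s(w, u) with hD
  set Γ : SimpleGraph V :=
    SimpleGraph.fromEdgeSet ((H ∪ D : Finset (Sym2 V)) : Set (Sym2 V)) ⊓ within G W with hΓdef
  have hΓ : Γ ≤ within G W := inf_le_right
  have hcutΓ : ∀ A B : Finset V, A ⊆ W → B ⊆ W → Disjoint A B → η * Fintype.card V ≤ A.card →
      (Fintype.card V : ℝ) / 4 ≤ B.card → ∃ a ∈ A, ∃ b ∈ B, Γ.Adj a b := by
    intro A B hA hB hAB h1 h2
    obtain ⟨a, ha, b, hb, hab⟩ := hH A B hAB h1 h2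
    have hadj : G.Adj a b := by simpa using hHG hab
    refine ⟨a, ha, b, hb, ?_, hadj, hA ha, hB hb⟩
    rw [SimpleGraph.fromEdgeSet_adj]
    exact ⟨by simp [hab], hadj.ne⟩
  have hdegΓ : ∀ w ∈ W, d ≤ (nbrs Γ w).card := by
    intro w hw
    rw [← hNcard w hw]
    refine Finset.card_le_card fun u hu => ?_
    have hu' := Finset.mem_inter.1 (hNsub w hw hu)
    have hadj := mem_nbrs.1 hu'.1
    rw [mem_nbrs]
    refine ⟨?_, hadj, hw, hu'.2⟩
    rw [SimpleGraph.fromEdgeSet_adj]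
    refine ⟨?_, hadj.ne⟩
    rw [Finset.mem_coe]
    exact Finset.mem_union_right _ (Finset.mem_biUnion.2 ⟨w, hw, Finset.mem_image.2 ⟨u, hu, rfl⟩⟩)
  have hexp : ∀ S ⊆ W, S.Nonempty → S.card ≤ Fintype.card V / 8 →
      2 * S.card ≤ (outerNeighbours Γ S).card := fun S hS hne hcard =>
    two_mul_card_le_outerNeighbours hL hδ hΓ hdegΓ hδd hcutΓ hdense hW hS hne hcard
  have hWne : W.Nonempty := by
    rw [← Finset.card_pos]
    have : (0 : ℝ) < W.card := lt_of_lt_of_le (by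
      have : (8 : ℝ) ≤ Fintype.card V := by exact_mod_cast hV
      linarith) hW
    exact_mod_cast this
  obtain ⟨Γ', hΓ'G, hcard, hsq, hdisj⟩ := exists_disjoint_boosters hWne hΓ
    (k := Fintype.card V / 8) (by omega) hexp
    (fun C hC hne hCW => exists_adj_sdiff_of_expansion hη8 (fun u v huv => (hΓ huv).2.2) hcutΓ
      hexp hW hC hne hCW) hham
  refine hboost ⟨Γ', hΓ'G, ?_, ?_, hdisj⟩
  · refine le_trans ?_ hM
    have h1 : edgesOf Γ ⊆ H ∪ D := by
      intro e he
      rw [mem_edgesOf] at he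
      have := SimpleGraph.edgeSet_mono (inf_le_left : Γ ≤ _) he
      rw [SimpleGraph.edgeSet_fromEdgeSet] at this
      exact Finset.mem_coe.1 this.1
    have h2 : D.card ≤ Fintype.card V * d := by
      refine Finset.card_biUnion_le.trans ?_
      calc ∑ w ∈ W, ((N w).image fun u => s(w, u)).card ≤ ∑ w ∈ W, d :=
            Finset.sum_le_sum fun w hw => Finset.card_image_le.trans (hNcard w hw).le
        _ = W.card * d := by simp
        _ ≤ _ := Nat.mul_le_mul_right _ (Finset.card_le_univ W)
    have h3 := (Finset.card_le_card h1).trans (Finset.card_union_le H D)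
    exact_mod_cast (by omega : (edgesOf Γ').card ≤
      ⌈32 * Fintype.card V / η⌉₊ + Fintype.card V * d + Fintype.card V)
  · have : (((Fintype.card V / 8 : ℕ) : ℝ)) ^ 2 ≤ 2 * (boosters Γ').card := by exact_mod_cast hsq
    linarith

end Structure

/-! ### Probabilities of the exceptional events. -/

section Probability

variable {V : Type*} [Fintype V] [DecidableEq V]

lemma crossPairs_subset_pairsOf {A B : Finset V} (h : Disjoint A B) :
    crossPairs A B ⊆ pairsOf V := by
  intro e he
  obtain ⟨a, ha, b, hb, rfl⟩ := mem_crossPairs.1 he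
  rw [mem_pairsOf, Sym2.mk_isDiag_iff]
  rintro rfl
  exact Finset.disjoint_left.1 h ha hb

lemma innerPairs_subset_pairsOf (T : Finset V) : innerPairs T ⊆ pairsOf V := by
  intro e he
  obtain ⟨⟨a, b⟩, hab, rfl⟩ := Finset.mem_image.1 he
  rw [mem_pairsOf, Sym2.mk_isDiag_iff]
  exact (Finset.mem_offDiag.1 hab).2.2

omit [Fintype V] in
lemma card_innerPairs_le (T : Finset V) : ((innerPairs T).card : ℝ) ≤ (T.card : ℝ) ^ 2 / 2 := by
  have : (innerPairs T).card = T.card.choose 2 := Sym2.card_image_offDiag T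
  rw [this, Nat.cast_choose_two]
  nlinarith [(Nat.cast_nonneg T.card : (0 : ℝ) ≤ _)]

lemma exp_neg_one_le : Real.exp (-1) ≤ 2 / 5 := by
  rw [Real.exp_neg, inv_le_comm₀ (Real.exp_pos _) (by norm_num)]
  linarith [Real.exp_one_gt_d9]

/-- The number of edges in `B` is unlikely to be at most `k`, if all of `A` is to be present. -/
lemma binomialRandom_real_lower_tail_le (p : unitInterval) {A B : Finset (Sym2 V)}
    (hA : A ⊆ pairsOf V) (hB : B ⊆ pairsOf V) (hAB : Disjoint A B) (k : ℝ)
    (S : Set (SimpleGraph V))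
    (hS : ∀ G ∈ S, A ⊆ edgesOf G ∧ ((edgesOf G ∩ B).card : ℝ) ≤ k) :
    (SimpleGraph.binomialRandom V p).real S ≤
      (p : ℝ) ^ A.card * Real.exp (k - 3 / 5 * p * B.card) := by
  -- With y = 1/e the exponent is k - (1 - 1/e)p|B|, and 1 - 1/e ≥ 3/5.
  have h := binomialRandom_real_le_of_pow p hA hB hAB (Real.exp_pos (-1)).le
    (Real.exp_pos (-k)) S (fun G hG => ⟨(hS G hG).1, by
      rw [← Real.exp_nat_mul, Real.exp_le_exp]
      linarith [(hS G hG).2]⟩)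
  refine h.trans ?_
  rw [mul_div_assoc, ← Real.exp_sub]
  have hp0 : (0 : ℝ) ≤ p := p.2.1
  refine mul_le_mul_of_nonneg_left (Real.exp_le_exp.2 ?_) (by positivity)
  have h1 : (0 : ℝ) ≤ p * B.card := by positivity
  nlinarith [mul_le_mul_of_nonneg_left exp_neg_one_le h1]

/-- The number of edges in `B` is unlikely to be large. -/
lemma binomialRandom_real_upper_tail_le (p : unitInterval) {B : Finset (Sym2 V)}
    (hB : B ⊆ pairsOf V) (k : ℝ) {t : ℝ} (ht : 0 ≤ t) (S : Set (SimpleGraph V))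
    (hS : ∀ G ∈ S, k ≤ ((edgesOf G ∩ B).card : ℝ)) :
    (SimpleGraph.binomialRandom V p).real S ≤
      Real.exp (p * (Real.exp t - 1) * B.card - t * k) := by
  have h := binomialRandom_real_le_of_pow p (Finset.empty_subset _) hB
    (Finset.disjoint_empty_left _) (Real.exp_pos t).le
    (Real.exp_pos (t * k)) S (fun G hG => ⟨Finset.empty_subset _, by
      rw [← Real.exp_nat_mul, Real.exp_le_exp, mul_comm]
      exact mul_le_mul_of_nonneg_right (hS G hG) ht⟩)
  refine h.trans (le_of_eq ?_)
  rw [Finset.card_empty, pow_zero, one_mul, Real.exp_sub]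

/-- For a fixed pair of sets the exponent is at most (1/2 - 3/5)|A||B|L/n ≤ -ηnL/40; there are at
most 4^n pairs. -/
lemma prob_sparseCut_le (p : unitInterval) {L η : ℝ} (hη : 0 < η) (hL : 0 ≤ L)
    (hV : 0 < Fintype.card V) (hp : L / Fintype.card V ≤ p) :
    (SimpleGraph.binomialRandom V p).real {G | SparseCut L η G} ≤
      4 ^ Fintype.card V * Real.exp (-(η * Fintype.card V * L / 40)) := by
  classical
  set n := Fintype.card V with hn
  have hn0 : (0 : ℝ) < n := by exact_mod_cast hV
  set I := (Finset.univ : Finset (Finset V × Finset V)).filter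
    fun x => Disjoint x.1 x.2 ∧ η * n ≤ x.1.card ∧ (n : ℝ) / 4 ≤ x.2.card with hI
  have hbound := measureReal_le_sum_of_subset (SimpleGraph.binomialRandom V p) I
    {G | SparseCut L η G}
    (fun x => {G | ((edgesOf G ∩ crossPairs x.1 x.2).card : ℝ) ≤
      x.1.card * x.2.card * L / (2 * n)})
    (fun _ => Real.exp (-(η * n * L / 40)))
    (by
      rintro G ⟨A, B, hAB, hA, hB, hG⟩
      exact ⟨(A, B), Finset.mem_filter.2 ⟨Finset.mem_univ _, hAB, hA, hB⟩, hG⟩)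
    (by
      rintro ⟨A, B⟩ hx
      obtain ⟨hAB, hA, hB⟩ := (Finset.mem_filter.1 hx).2
      simp only at hAB hA hB ⊢
      refine (binomialRandom_real_lower_tail_le p (Finset.empty_subset _)
        (crossPairs_subset_pairsOf hAB) (Finset.disjoint_empty_left _)
        (A.card * B.card * L / (2 * n)) _ fun G hG => ⟨Finset.empty_subset _, hG⟩).trans ?_
      rw [Finset.card_empty, pow_zero, one_mul, Real.exp_le_exp, card_crossPairs hAB, Nat.cast_mul]
      set q : ℝ := A.card * B.card with hq
      have hq1 : η * n * (n / 4) ≤ q := mul_le_mul hA hB (by positivity) (by positivity)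
      have hq0 : 0 ≤ q := by positivity
      have h1 : q * (L / n) ≤ q * p := mul_le_mul_of_nonneg_left hp hq0
      have h2 : q * L / (2 * n) = q * (L / n) / 2 := by field_simp
      have h3 : η * n * (n / 4) * (L / n) ≤ q * (L / n) :=
        mul_le_mul_of_nonneg_right hq1 (by positivity)
      have h4 : η * n * (n / 4) * (L / n) = η * n * L / 4 := by field_simp
      rw [h2]
      linarith)
  refine hbound.trans ?_
  rw [Finset.sum_const, nsmul_eq_mul]
  gcongr
  have : I.card ≤ 4 ^ n := by
    refine (Finset.card_le_card (Finset.filter_subset _ _)).trans ?_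
    rw [Finset.card_univ, Fintype.card_prod, Fintype.card_finset, ← mul_pow]
    norm_num [hn]
  exact_mod_cast this

/-- The star pairs and the pairs from S to the outside are disjoint, so both conditions fit one
Markov bound. For n ≥ 40 the latter number at least 3 · 9n/10, and 3/10 - 3/5 · 27/10 = -33/25. The
at most n⁴ choices meet the factor (2L/n)³. -/
lemma prob_smallStar_le (p : unitInterval) {L : ℝ} (hL : 0 ≤ L) (hV : 40 ≤ Fintype.card V)
    (hp : L / Fintype.card V ≤ p) (hp' : (p : ℝ) ≤ 2 * L / Fintype.card V) :
    (SimpleGraph.binomialRandom V p).real {G | SmallStar L G} ≤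
      8 * L ^ 3 * Fintype.card V * Real.exp (-(33 / 25 * L)) := by
  classical
  set n := Fintype.card V with hn
  have hn40 : (40 : ℝ) ≤ n := by exact_mod_cast hV
  have hn0 : (0 : ℝ) < n := by linarith
  have hp0 : (0 : ℝ) ≤ p := p.2.1
  set I := ((Finset.univ : Finset V) ×ˢ (Finset.univ : Finset V).powersetCard 3).filter
    fun x => x.1 ∉ x.2 with hI
  have hbound := measureReal_le_sum_of_subset (SimpleGraph.binomialRandom V p) I
    {G | SmallStar L G}
    (fun x => {G | (∀ s ∈ x.2, G.Adj x.1 s) ∧ ∀ s ∈ x.2, ((nbrs G s).card : ℝ) < L / 10})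
    (fun _ => (2 * L / n) ^ 3 * Real.exp (-(33 / 25 * L)))
    (by
      rintro G ⟨v, S, hv, hS, hG⟩
      refine ⟨(v, S), Finset.mem_filter.2 ⟨?_, hv⟩, hG⟩
      simp [hS])
    (by
      rintro ⟨v, S⟩ hx
      obtain ⟨hx1, hvS⟩ := Finset.mem_filter.1 hx
      have hS : S.card = 3 := by
        simpa using hx1
      simp only at hvS ⊢
      have hd1 : Disjoint {v} S := by simpa using hvS
      have hd2 : Disjoint S (insert v S)ᶜ := Finset.disjoint_left.2 fun x hx hx' =>
        Finset.mem_compl.1 hx' (Finset.mem_insert_of_mem hx)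
      have hd3 : Disjoint (crossPairs {v} S) (crossPairs S (insert v S)ᶜ) := by
        refine Finset.disjoint_left.2 fun e he he' => ?_
        obtain ⟨a, ha, b, hb, rfl⟩ := mem_crossPairs.1 he
        obtain ⟨c, hc, d, hd, h⟩ := mem_crossPairs.1 he'
        rw [Finset.mem_singleton] at ha
        subst ha
        rw [Finset.mem_compl, Finset.mem_insert] at hd
        rw [Sym2.eq_iff] at h
        rcases h with ⟨rfl, rfl⟩ | ⟨rfl, rfl⟩
        · exact hvS hc
        · exact hd (Or.inl rfl)
      refine (binomialRandom_real_lower_tail_le p (crossPairs_subset_pairsOf hd1)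
        (crossPairs_subset_pairsOf hd2) hd3 (3 * (L / 10)) _ fun G hG => ⟨?_, ?_⟩).trans ?_
      · intro e he
        obtain ⟨a, ha, b, hb, rfl⟩ := mem_crossPairs.1 he
        rw [Finset.mem_singleton] at ha
        subst ha
        simpa using hG.1 b hb
      · have h1 : ((edgesOf G ∩ crossPairs S (insert v S)ᶜ).card : ℝ) ≤
            ∑ s ∈ S, ((nbrs G s).card : ℝ) := by
          exact_mod_cast card_edgesOf_inter_crossPairs_le G S _
        refine h1.trans ((Finset.sum_le_card_nsmul S _ (L / 10) fun s hs => (hG.2 s hs).le).trans ?_)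
        rw [hS, nsmul_eq_mul]
        norm_num
      · rw [card_crossPairs hd1, card_crossPairs hd2, hS, Finset.card_singleton, one_mul,
          Finset.card_compl, Finset.card_insert_of_notMem hvS, hS, ← hn, Nat.cast_mul,
          Nat.cast_sub (by omega)]
        push_cast
        gcongr
        have h1 : (9 / 10 : ℝ) * n * (L / n) ≤ (n - (3 + 1)) * p :=
          mul_le_mul (by linarith) hp (by positivity) (by linarith)
        have h2 : (9 / 10 : ℝ) * n * (L / n) = 9 / 10 * L := by field_simp
        linarith)
  refine hbound.trans ?_
  rw [Finset.sum_const, nsmul_eq_mul]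
  have hcard : (I.card : ℝ) ≤ (n : ℝ) ^ 4 := by
    have : I.card ≤ n ^ 4 := by
      refine (Finset.card_le_card (Finset.filter_subset _ _)).trans ?_
      rw [Finset.card_product, Finset.card_powersetCard, Finset.card_univ, ← hn]
      calc n * n.choose 3 ≤ n * n ^ 3 := Nat.mul_le_mul_left _ (Nat.choose_le_pow n 3)
        _ = n ^ 4 := by ring
    exact_mod_cast this
  calc (I.card : ℝ) * ((2 * L / n) ^ 3 * Real.exp (-(33 / 25 * L)))
      ≤ (n : ℝ) ^ 4 * ((2 * L / n) ^ 3 * Real.exp (-(33 / 25 * L))) := by gcongr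
    _ = _ := by field_simp; ring

/-- The tilt t = 24/δ turns the edge requirement into 4|T|L, while the size bound on T keeps the
mean term below |T|L. Each T thus costs at most z^|T| with z = exp(-3L), and summing over nonempty T
gives (1 + z)^n - 1. -/
lemma prob_denseSet_le (p : unitInterval) {L δ : ℝ} (hL : 0 ≤ L) (hδ : 0 < δ)
    (hV : 0 < Fintype.card V) (hp' : (p : ℝ) ≤ 2 * L / Fintype.card V) :
    (SimpleGraph.binomialRandom V p).real {G | DenseSet L δ (Real.exp (-(24 / δ))) G} ≤
      Real.exp (Fintype.card V * Real.exp (-(3 * L))) - 1 := by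
  classical
  set n := Fintype.card V with hn
  have hn0 : (0 : ℝ) < n := by exact_mod_cast hV
  have hp0 : (0 : ℝ) ≤ p := p.2.1
  set z := Real.exp (-(3 * L)) with hz
  set I := ((Finset.univ : Finset V).powerset.erase ∅).filter
    fun T => (T.card : ℝ) ≤ Real.exp (-(24 / δ)) * n with hI
  have hbound := measureReal_le_sum_of_subset (SimpleGraph.binomialRandom V p) I
    {G | DenseSet L δ (Real.exp (-(24 / δ))) G}
    (fun T => {G | δ * T.card * L / 6 ≤ (edgesOf G ∩ innerPairs T).card})
    (fun T => z ^ T.card)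
    (by
      rintro G ⟨T, hT, hTcard, hG⟩
      exact ⟨T, Finset.mem_filter.2 ⟨Finset.mem_erase.2 ⟨hT.ne_empty, by simp⟩, hTcard⟩, hG⟩)
    (by
      intro T hT
      have hTcard := (Finset.mem_filter.1 hT).2
      have ht : 0 ≤ 24 / δ := by positivity
      refine (binomialRandom_real_upper_tail_le p (innerPairs_subset_pairsOf T)
        (δ * T.card * L / 6) ht _ fun G hG => hG).trans ?_
      rw [hz, ← Real.exp_nat_mul, Real.exp_le_exp]
      have h1 : 24 / δ * (δ * T.card * L / 6) = 4 * (T.card * L) := by field_simp; ring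
      have hX1 : 1 ≤ Real.exp (24 / δ) := Real.one_le_exp ht
      have hX : Real.exp (24 / δ) * T.card ≤ n := by
        calc Real.exp (24 / δ) * T.card ≤ Real.exp (24 / δ) * (Real.exp (-(24 / δ)) * n) := by
              gcongr
          _ = n := by rw [← mul_assoc, ← Real.exp_add]; simp
      have h2 : p * (Real.exp (24 / δ) - 1) * (innerPairs T).card ≤ T.card * L := by
        calc p * (Real.exp (24 / δ) - 1) * (innerPairs T).card
            ≤ (2 * L / n) * Real.exp (24 / δ) * ((T.card : ℝ) ^ 2 / 2) := by
              gcongr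
              · linarith
              · exact card_innerPairs_le T
          _ = (T.card * L / n) * (Real.exp (24 / δ) * T.card) := by ring
          _ ≤ (T.card * L / n) * n := by gcongr
          _ = _ := by field_simp
      rw [h1]
      linarith)
  refine hbound.trans ?_
  have hz0 : 0 ≤ z := (Real.exp_pos _).le
  have h1 : ∑ T ∈ I, z ^ T.card ≤ ∑ T ∈ (Finset.univ : Finset V).powerset.erase ∅, z ^ T.card :=
    Finset.sum_le_sum_of_subset_of_nonneg (Finset.filter_subset _ _) fun T _ _ => by positivity
  have h2 : ∑ T ∈ (Finset.univ : Finset V).powerset.erase ∅, z ^ T.card = (1 + z) ^ n - 1 := by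
    have h3 := Finset.prod_one_add (f := fun _ : V => z) Finset.univ
    simp only [Finset.prod_const, Finset.card_univ] at h3
    rw [h3, ← Finset.sum_erase_add _ _ (Finset.empty_mem_powerset _)]
    simp
  have h3 : (1 + z) ^ n ≤ Real.exp (n * z) := by
    rw [Real.exp_nat_mul]
    exact pow_le_pow_left₀ (by positivity) (by linarith [Real.add_one_le_exp z]) _
  linarith

lemma prob_manyEdges_le (p : unitInterval) {L : ℝ} (hL : 0 ≤ L)
    (hV : 0 < Fintype.card V) (hp' : (p : ℝ) ≤ 2 * L / Fintype.card V) :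
    (SimpleGraph.binomialRandom V p).real
        {G | 2 * Fintype.card V * L < ((edgesOf G).card : ℝ)} ≤
      Real.exp (-(Fintype.card V * L / 4)) := by
  set n := Fintype.card V with hn
  have hn0 : (0 : ℝ) < n := by exact_mod_cast hV
  have hp0 : (0 : ℝ) ≤ p := p.2.1
  refine (binomialRandom_real_upper_tail_le p (Finset.Subset.refl (pairsOf V)) (2 * n * L)
    zero_le_one _ fun G hG => ?_).trans ?_
  · rw [Finset.inter_eq_left.2 (edgesOf_subset_pairsOf G)]
    exact le_of_lt hG
  · rw [Real.exp_le_exp]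
    have he : Real.exp 1 - 1 ≤ 7 / 4 := by linarith [Real.exp_one_lt_d9]
    have he0 : 0 ≤ Real.exp 1 - 1 := by linarith [Real.exp_one_gt_d9]
    have h1 : p * (Real.exp 1 - 1) * (pairsOf V).card ≤ 7 / 4 * (n * L) := by
      calc p * (Real.exp 1 - 1) * (pairsOf V).card ≤ (2 * L / n) * (7 / 4) * ((n : ℝ) ^ 2 / 2) := by
            gcongr
            exact card_pairsOf_le
        _ = _ := by field_simp
    linarith

/-- Union bound over Γ, using that its boosters avoid its own edges. Taking y = 0 in the Markov
bound gives p^|Γ| · exp(-pb). -/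
lemma prob_hasUnusedBoosters_le (p : unitInterval) {M b : ℝ} :
    (SimpleGraph.binomialRandom V p).real {G | HasUnusedBoosters M b G} ≤
      Real.exp (M * Real.log 512 + p * (pairsOf V).card / 512 - p * b) := by
  classical
  have hp0 : (0 : ℝ) ≤ p := p.2.1
  set I := (pairsOf V).powerset.filter fun s : Finset (Sym2 V) => (s.card : ℝ) ≤ M ∧
    b ≤ (boosters (SimpleGraph.fromEdgeSet (s : Set (Sym2 V)))).card ∧
      Disjoint s (boosters (SimpleGraph.fromEdgeSet (s : Set (Sym2 V)))) with hI
  have hbound := measureReal_le_sum_of_subset (SimpleGraph.binomialRandom V p) I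
    {G | HasUnusedBoosters M b G}
    (fun s : Finset (Sym2 V) => {G | s ⊆ edgesOf G ∧
      edgesOf G ∩ boosters (SimpleGraph.fromEdgeSet (s : Set (Sym2 V))) = ∅})
    (fun s : Finset (Sym2 V) => (p : ℝ) ^ s.card * Real.exp (-(p * b)))
    (by
      rintro G ⟨Γ, hΓ, hM, hb, hdisj⟩
      refine ⟨edgesOf Γ, Finset.mem_filter.2 ⟨?_, hM, ?_, ?_⟩, edgesOf_mono hΓ, ?_⟩
      · exact Finset.mem_powerset.2 (edgesOf_subset_pairsOf Γ)
      · rwa [fromEdgeSet_edgesOf]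
      · rw [fromEdgeSet_edgesOf]
        exact (hdisj.mono_right (edgesOf_mono hΓ)).symm
      · rw [fromEdgeSet_edgesOf]
        exact Finset.disjoint_iff_inter_eq_empty.1 hdisj.symm)
    (by
      intro s hs
      obtain ⟨hs1, -, hb, hdisj⟩ := Finset.mem_filter.1 hs
      have h := binomialRandom_real_le_of_pow p (Finset.mem_powerset.1 hs1)
        (fun e he => mem_pairsOf.2 (mem_boosters.1 he).1) hdisj le_rfl one_pos
        {G | s ⊆ edgesOf G ∧
          edgesOf G ∩ boosters (SimpleGraph.fromEdgeSet (s : Set (Sym2 V))) = ∅}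
        (fun G hG => ⟨hG.1, by rw [hG.2]; simp⟩)
      refine h.trans ?_
      rw [div_one]
      gcongr
      nlinarith [mul_le_mul_of_nonneg_left hb hp0])
  refine hbound.trans ?_
  -- Since |s| ≤ M, trading p for p/512 costs at most 512^M; the sum of (p/512)^|s| over all sets of
  -- pairs is then a product.
  have hterm : ∀ s ∈ I, (p : ℝ) ^ s.card * Real.exp (-(p * b)) ≤
      (p / 512 : ℝ) ^ s.card * (Real.exp (M * Real.log 512) * Real.exp (-(p * b))) := by
    intro s hs
    have hM := (Finset.mem_filter.1 hs).2.1
    have h1 : (512 : ℝ) ^ s.card ≤ Real.exp (M * Real.log 512) := by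
      calc (512 : ℝ) ^ s.card = Real.exp (s.card * Real.log 512) := by
            rw [Real.exp_nat_mul, Real.exp_log (by norm_num)]
        _ ≤ _ := Real.exp_le_exp.2 (mul_le_mul_of_nonneg_right hM (Real.log_nonneg (by norm_num)))
    calc (p : ℝ) ^ s.card * Real.exp (-(p * b))
        = (p / 512 : ℝ) ^ s.card * ((512 : ℝ) ^ s.card * Real.exp (-(p * b))) := by
          rw [← mul_assoc, ← mul_pow]; congr 2; ring
      _ ≤ _ := by gcongr
  refine (Finset.sum_le_sum hterm).trans ?_
  rw [← Finset.sum_mul]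
  have h1 : ∑ s ∈ I, (p / 512 : ℝ) ^ s.card ≤ ∑ s ∈ (pairsOf V).powerset, (p / 512 : ℝ) ^ s.card :=
    Finset.sum_le_sum_of_subset_of_nonneg (Finset.filter_subset _ _) fun s _ _ => by positivity
  have h2 : ∑ s ∈ (pairsOf V).powerset, (p / 512 : ℝ) ^ s.card =
      (1 + p / 512 : ℝ) ^ (pairsOf V).card := by
    have h3 := Finset.prod_one_add (f := fun _ : Sym2 V => (p / 512 : ℝ)) (pairsOf V)
    simp only [Finset.prod_const] at h3
    exact h3.symm
  have h3 : (1 + p / 512 : ℝ) ^ (pairsOf V).card ≤ Real.exp (p * (pairsOf V).card / 512) := by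
    rw [show (p : ℝ) * (pairsOf V).card / 512 = (pairsOf V).card * (p / 512) by ring,
      Real.exp_nat_mul]
    exact pow_le_pow_left₀ (by positivity) (by linarith [Real.add_one_le_exp (p / 512 : ℝ)]) _
  calc (∑ s ∈ I, (p / 512 : ℝ) ^ s.card) * (Real.exp (M * Real.log 512) * Real.exp (-(p * b)))
      ≤ Real.exp (p * (pairsOf V).card / 512) *
        (Real.exp (M * Real.log 512) * Real.exp (-(p * b))) := by
        gcongr
        exact (h1.trans_eq h2).trans h3
    _ = _ := by
        rw [← Real.exp_add, ← Real.exp_add]; congr 1; ring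

end Probability

/-! ### Choice of constants and passage to the limit. -/

section Limit

lemma largeVertices_eq_highDegree {n : ℕ} (G : SimpleGraph (Fin n)) :
    largeVertices G = (highDegree (Real.log n) G : Set (Fin n)) := by
  classical
  ext v
  have : G.degree v = (nbrs G v).card := by
    rw [← SimpleGraph.card_neighborFinset_eq_degree]
    congr 1
    ext u
    simp [mem_nbrs]
  rw [Finset.mem_coe, mem_highDegree, ← this]
  unfold largeVertices
  rw [Set.mem_ofPred_eq]

/-- A bound for the probability that the large vertices do not span a Hamiltonian graph. -/
noncomputable def failureBound (L : ℝ) : ℝ :=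
  Real.exp (-L) + 8 * L ^ 3 * Real.exp (-(8 / 25 * L)) + (Real.exp (Real.exp (-(2 * L))) - 1) +
    Real.exp (-(L / 4)) + Real.exp (-(L / 1000))

lemma tendsto_exp_neg_mul {c : ℝ} (hc : 0 < c) :
    Tendsto (fun L : ℝ => Real.exp (-(c * L))) atTop (𝓝 0) :=
  Real.tendsto_exp_neg_atTop_nhds_zero.comp (tendsto_id.const_mul_atTop hc)

lemma tendsto_failureBound : Tendsto failureBound atTop (𝓝 0) := by
  have h1 : Tendsto (fun L : ℝ => Real.exp (-L)) atTop (𝓝 0) :=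
    Real.tendsto_exp_neg_atTop_nhds_zero
  have h2 : Tendsto (fun L : ℝ => 8 * L ^ 3 * Real.exp (-(8 / 25 * L))) atTop (𝓝 0) := by
    have h := ((Real.tendsto_pow_mul_exp_neg_atTop_nhds_zero 3).comp
      (tendsto_id.const_mul_atTop (show (0 : ℝ) < 8 / 25 by norm_num))).const_mul (8 * (25 / 8) ^ 3)
    rw [mul_zero] at h
    refine h.congr fun L => ?_
    simp only [Function.comp, id]
    ring
  have h3 : Tendsto (fun L : ℝ => Real.exp (Real.exp (-(2 * L))) - 1) atTop (𝓝 0) := by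
    have h := (Real.continuous_exp.tendsto 0).comp (tendsto_exp_neg_mul (c := 2) (by norm_num))
    rw [Real.exp_zero] at h
    simpa using h.sub_const 1
  have h4 : Tendsto (fun L : ℝ => Real.exp (-(L / 4))) atTop (𝓝 0) := by
    simpa [div_eq_inv_mul] using tendsto_exp_neg_mul (c := 4⁻¹) (by norm_num)
  have h5 : Tendsto (fun L : ℝ => Real.exp (-(L / 1000))) atTop (𝓝 0) := by
    simpa [div_eq_inv_mul] using tendsto_exp_neg_mul (c := 1000⁻¹) (by norm_num)
  have h := (((h1.add h2).add h3).add h4).add h5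
  simp only [add_zero] at h
  exact h

/-- For `η` a small constant and `log n` large compared with `η⁻¹`, the failure probability is at
most `failureBound (log n)`. -/
lemma binomialRandom_real_compl_le {n : ℕ} (p : unitInterval) {η : ℝ}
    (hη : 3 * η = Real.exp (-(24 / (1 / 10000)))) (hn : 40 ≤ n)
    (hL : 640000 / η + 40000 ≤ Real.log n)
    (hp : Real.log n / n ≤ p) (hp' : (p : ℝ) ≤ 2 * Real.log n / n) :
    (SimpleGraph.binomialRandom (Fin n) p).real
        {G : SimpleGraph (Fin n) | HasHamiltonianCycle (G.induce (largeVertices G))}ᶜ ≤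
      failureBound (Real.log n) := by
  set μ := SimpleGraph.binomialRandom (Fin n) p with hμ
  set L := Real.log n with hLdef
  have hη0 : 0 < η := by linarith [Real.exp_pos (-(24 / (1 / 10000) : ℝ))]
  have hη8 : η ≤ 1 / 8 := by
    have h1 : Real.exp (-(24 / (1 / 10000)) : ℝ) ≤ Real.exp (-1 + -1) :=
      Real.exp_le_exp.2 (by norm_num)
    rw [Real.exp_add] at h1
    nlinarith [exp_neg_one_le, Real.exp_pos (-1)]
  have hη' : 0 < 640000 / η := by positivity
  have hL0 : 0 < L := by linarith
  have hnR : (40 : ℝ) ≤ n := by exact_mod_cast hn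
  have hn0 : (0 : ℝ) < n := by linarith
  have hcard : Fintype.card (Fin n) = n := Fintype.card_fin n
  -- M leaves room for 32n/η + nd + n edges with d = ⌈L/10000⌉, as L is large against 1/η. For b,
  -- ⌊n/8⌋ ≥ n/10 once n ≥ 35.
  set M : ℝ := n * L / 5000 with hM
  set b : ℝ := (n : ℝ) ^ 2 / 200 with hb
  have hsub : {G : SimpleGraph (Fin n) | HasHamiltonianCycle (G.induce (largeVertices G))}ᶜ ⊆
      {G | SparseCut L η G} ∪ {G | SmallStar L G} ∪ {G | DenseSet L (1 / 10000) (3 * η) G} ∪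
        {G | 2 * Fintype.card (Fin n) * L < ((edgesOf G).card : ℝ)} ∪
          {G | HasUnusedBoosters M b G} := by
    intro G hG
    by_contra hcon
    simp only [Set.mem_union, Set.mem_ofPred_eq, not_or, not_lt] at hcon
    obtain ⟨⟨⟨⟨h1, h2⟩, h3⟩, h4⟩, h5⟩ := hcon
    apply hG
    rw [Set.mem_ofPred_eq, largeVertices_eq_highDegree]
    have hd1 := Nat.le_ceil (1 / 10000 * L)
    have hd2 := Nat.ceil_lt_add_one (show 0 ≤ 1 / 10000 * L by positivity)
    refine hasHamiltonianCycle_of_typical (d := ⌈1 / 10000 * L⌉₊) (δ := 1 / 10000) hL0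
      (by norm_num) hη0 hη8 (by omega) hd1 (by linarith) ?_ ?_ h1 h2 h3 h4 h5
    · rw [hcard]
      push_cast
      have h6 := Nat.ceil_lt_add_one (show 0 ≤ 32 * n / η by positivity)
      have h7 : (n : ℝ) * ⌈1 / 10000 * L⌉₊ ≤ n * (1 / 10000 * L + 1) := by gcongr
      have h8 : (n : ℝ) * (640000 / η + 40000) ≤ n * L := by gcongr
      have h9 : (n : ℝ) * (640000 / η) = 20000 * (32 * n / η) := by ring
      have h10 : 0 ≤ 32 * n / η := by positivity
      rw [hM]
      linarith
    · rw [hcard, hb]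
      have h6 : n ≤ 8 * (n / 8) + 7 := by omega
      have h7 : (n : ℝ) ≤ 8 * (n / 8 : ℕ) + 7 := by exact_mod_cast h6
      have h8 : (n : ℝ) / 10 ≤ (n / 8 : ℕ) := by linarith
      calc 2 * ((n : ℝ) ^ 2 / 200) = (n / 10 : ℝ) ^ 2 := by ring
        _ ≤ _ := by gcongr
  have hcut := prob_sparseCut_le (V := Fin n) p hη0 hL0.le (by omega) (by rwa [hcard])
  have hstar := prob_smallStar_le (V := Fin n) p hL0.le (by omega) (by rwa [hcard]) (by rwa [hcard])
  have hdense := prob_denseSet_le (V := Fin n) p (δ := 1 / 10000) hL0.le (by norm_num) (by omega)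
    (by rwa [hcard])
  have hmany := prob_manyEdges_le (V := Fin n) p hL0.le (by omega) (by rwa [hcard])
  have hboost := prob_hasUnusedBoosters_le (V := Fin n) p (M := M) (b := b)
  have hN := card_pairsOf_le (V := Fin n)
  rw [← hη] at hdense
  simp only [hcard] at hcut hstar hdense hmany hN
  have hnexp : (n : ℝ) = Real.exp L := (Real.exp_log hn0).symm
  have hnL : L ≤ n := by
    rw [hnexp]; linarith [Real.add_one_le_exp L]
  have e1 : 4 ^ n * Real.exp (-(η * n * L / 40)) ≤ Real.exp (-L) := by
    have h4 : (4 : ℝ) ≤ Real.exp 2 := by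
      rw [show (2 : ℝ) = 1 + 1 by norm_num, Real.exp_add]
      nlinarith [Real.exp_one_gt_d9]
    calc 4 ^ n * Real.exp (-(η * n * L / 40))
        ≤ Real.exp 2 ^ n * Real.exp (-(η * n * L / 40)) := by gcongr
      _ = Real.exp (n * 2 - η * n * L / 40) := by
          rw [← Real.exp_nat_mul, ← Real.exp_add]; rfl
      _ ≤ _ := by
          rw [Real.exp_le_exp]
          have h5 : 640000 ≤ η * L := by
            have := mul_le_mul_of_nonneg_left hL hη0.le
            rw [mul_add, mul_div_cancel₀ _ hη0.ne'] at this
            linarith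
          nlinarith [mul_le_mul_of_nonneg_left h5 hn0.le]
  have e2 : 8 * L ^ 3 * n * Real.exp (-(33 / 25 * L)) = 8 * L ^ 3 * Real.exp (-(8 / 25 * L)) := by
    rw [mul_assoc, hnexp, ← Real.exp_add]
    congr 2
    ring
  have e3 : n * Real.exp (-(3 * L)) = Real.exp (-(2 * L)) := by
    rw [hnexp, ← Real.exp_add]
    congr 1
    ring
  have hLn : L ≤ n * L := le_mul_of_one_le_left hL0.le (by linarith)
  have e4 : Real.exp (-(n * L / 4)) ≤ Real.exp (-(L / 4)) := Real.exp_le_exp.2 (by linarith)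
  -- In units of nL the exponent is at most 6.24/5000 + 1/512 - 1/200 < -1/1000.
  have e5 : Real.exp (M * Real.log 512 + p * (pairsOf (Fin n)).card / 512 - p * b) ≤
      Real.exp (-(L / 1000)) := by
    rw [Real.exp_le_exp]
    have hlog : Real.log 512 ≤ 6.24 := by
      rw [show (512 : ℝ) = 2 ^ 9 by norm_num, Real.log_pow]
      have := Real.log_two_lt_d9
      norm_num at this ⊢
      linarith
    have hp0 : (0 : ℝ) ≤ p := p.2.1
    have h1 : M * Real.log 512 ≤ n * L / 5000 * 6.24 := by
      rw [hM]; gcongr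
    have h2 : (p : ℝ) * (pairsOf (Fin n)).card ≤ n * L := by
      calc (p : ℝ) * (pairsOf (Fin n)).card ≤ (2 * L / n) * ((n : ℝ) ^ 2 / 2) :=
            mul_le_mul hp' hN (Nat.cast_nonneg _) (hp0.trans hp')
        _ = n * L := by rw [div_mul_div_comm, div_eq_iff (by positivity)]; ring
    have h3 : n * L / 200 ≤ p * b := by
      calc n * L / 200 = (L / n) * b := by rw [hb]; field_simp
        _ ≤ _ := by gcongr
    norm_num at h1
    linarith
  calc μ.real {G : SimpleGraph (Fin n) | HasHamiltonianCycle (G.induce (largeVertices G))}ᶜ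
      ≤ μ.real ({G | SparseCut L η G} ∪ {G | SmallStar L G} ∪
          {G | DenseSet L (1 / 10000) (3 * η) G} ∪
          {G | 2 * Fintype.card (Fin n) * L < ((edgesOf G).card : ℝ)} ∪
          {G | HasUnusedBoosters M b G}) := MeasureTheory.measureReal_mono hsub
    _ ≤ μ.real {G | SparseCut L η G} + μ.real {G | SmallStar L G} +
          μ.real {G | DenseSet L (1 / 10000) (3 * η) G} +
          μ.real {G | 2 * Fintype.card (Fin n) * L < ((edgesOf G).card : ℝ)} +
          μ.real {G | HasUnusedBoosters M b G} := by
        refine (MeasureTheory.measureReal_union_le _ _).trans (add_le_add_left ?_ _)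
        refine (MeasureTheory.measureReal_union_le _ _).trans (add_le_add_left ?_ _)
        refine (MeasureTheory.measureReal_union_le _ _).trans (add_le_add_left ?_ _)
        exact MeasureTheory.measureReal_union_le _ _
    _ ≤ failureBound L := by
        rw [hcard]
        rw [e2] at hstar
        rw [e3] at hdense
        unfold failureBound
        linarith

end Limit

theorem lemma2p6 (α : ℕ → ℝ) (hα : Tendsto α atTop atTop)
    (hα_log : α =o[atTop] fun n : ℕ => Real.log n)
    (p : ℕ → unitInterval)
    (hp : ∀ᶠ n : ℕ in atTop, (p n : ℝ) = (Real.log n + α n) / n) :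
    Tendsto
      (fun n : ℕ => SimpleGraph.binomialRandom (Fin n) (p n)
        {G : SimpleGraph (Fin n) | HasHamiltonianCycle (G.induce (largeVertices G))})
      atTop (𝓝 1) := by
  have hlog : Tendsto (fun n : ℕ => Real.log n) atTop atTop :=
    Real.tendsto_log_atTop.comp tendsto_natCast_atTop_atTop
  obtain ⟨η, hη⟩ : ∃ η : ℝ, 3 * η = Real.exp (-(24 / (1 / 10000))) :=
    ⟨Real.exp (-(24 / (1 / 10000))) / 3, by ring⟩
  have hbound : ∀ᶠ n : ℕ in atTop, (SimpleGraph.binomialRandom (Fin n) (p n)).real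
      {G : SimpleGraph (Fin n) | HasHamiltonianCycle (G.induce (largeVertices G))}ᶜ ≤
      failureBound (Real.log n) := by
    -- Eventually 0 ≤ α(n) ≤ log n, which gives log n / n ≤ p ≤ 2 log n / n.
    filter_upwards [hp, hα.eventually_ge_atTop 0, hα_log.bound one_pos, eventually_ge_atTop 40,
      hlog.eventually_ge_atTop (640000 / η + 40000), hlog.eventually_ge_atTop 0]
      with n hpn hα0 hαn hn hL hL0
    rw [one_mul, Real.norm_of_nonneg hα0, Real.norm_of_nonneg hL0] at hαn
    refine binomialRandom_real_compl_le (p n) hη hn hL ?_ ?_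
    · rw [hpn]
      gcongr
      linarith
    · rw [hpn]
      gcongr
      linarith
  have hzero : Tendsto (fun n : ℕ => (SimpleGraph.binomialRandom (Fin n) (p n)).real
      {G : SimpleGraph (Fin n) | HasHamiltonianCycle (G.induce (largeVertices G))}ᶜ) atTop (𝓝 0) :=
    squeeze_zero' (Eventually.of_forall fun _ => MeasureTheory.measureReal_nonneg) hbound
      (tendsto_failureBound.comp hlog)
  have hone := ENNReal.tendsto_ofReal (hzero.const_sub 1)
  rw [sub_zero, ENNReal.ofReal_one] at hone
  refine hone.congr fun n => ?_
  rw [← MeasureTheory.probReal_compl_eq_one_sub (Set.toFinite _).measurableSet, compl_compl,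
    MeasureTheory.ofReal_measureReal]
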